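/- Let $\langle y\rangle=\sqrt{1+y^2}$ and let $\mathbb H^1=\{(y,\langle y\rangle):y\in\mathbb R\}\subset\mathbb R^2$ be the hyperbola, equipped with the Lorentz invariant measure $d\sigma=dy/\langle y\rangle$. Functions on $\mathbb H^1$ are identified with functions of $y\in\mathbb R$, so that $\|f\|_{L^r(\mathbb H^1)}=\left(\int_{\mathbb R}|f(y)|^r\,\frac{dy}{\langle y\rangle}\right)^{1/r}$. The Fourier extension operator is $$Tf(x,t)=\int_{\mathbb R}e^{ixy}e^{it\langle y\rangle}f(y)\,\frac{dy}{\langle y\rangle},\qquad (x,t)\in\mathbb R^2,$$ for $f$ integrable with respect to $\sigma$ (in particular for Schwartz functions). For general $f\in L^2(\mathbb H^1)$, $Tf$ denotes the locally integrable function on $\mathbb R^2$ (unique up to null sets) which satisfies this identity in the sense of distributions: $$\int_{\mathbb R^2}Tf\,\varphi\,dx\,dt=\int_{\mathbb R}f(y)\left(\int_{\mathbb R^2}e^{ixy}e^{it\langle y\rangle}\varphi(x,t)\,dx\,dt\right)\frac{dy}{\langle y\rangle}\qquad\text{for all }\varphi\in C_c^\infty(\mathbb R^2).$$ For $k\in\mathbb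 Z$ let $\mathcal C_k=\{(y,\langle y\rangle)\in\mathbb H^1:\sinh(k-\tfrac12)\le y<\sinh(k+\tfrac12)\}$ and $f_k=f\mathbb 1_{\mathcal C_k}$. Then the function $Tf$ exists for every $f\in L^2(\mathbb H^1)$, and the following hold. 1. Let $3\le q<\infty$. There is a constant $C_q<\infty$, depending only on $q$, such that for every $f\in L^2(\mathbb H^1)$ $$\|Tf\|_{L^{2q}(\mathbb R^2)}\le C_q\left(\sum_{k\in\mathbb Z}\|f_k\|_{L^{\frac{2q}{2q-3}}(\mathbb H^1)}^3\right)^{1/3}.$$ 2. Let $6\le p<\infty$. There is a constant $C_p<\infty$, depending only on $p$, such that for every $f\in L^2(\mathbb H^1)$ $$\|Tf\|_{L^p(\mathbb R^2)}\le C_p\,\sup_{k\in\mathbb Z}\|f_k\|_{L^2(\mathbb H^1)}^{1/3}\,\|f\|_{L^2(\mathbb H^1)}^{2/3}.$$ -/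

import Mathlib

open MeasureTheory
open scoped ENNReal NNReal ContDiff

noncomputable section

namespace Hyperbola

/-- The Japanese bracket `⟨y⟩ = √(1 + y²)`. -/
def bracket (y : ℝ) : ℝ := Real.sqrt (1 + y ^ 2)

/-- The Lorentz invariant measure `dσ = dy / ⟨y⟩` on the hyperbola
`ℍ¹ = {(y, ⟨y⟩) : y ∈ ℝ}`. Functions on `ℍ¹` are identified with functions of `y ∈ ℝ`. -/
def sigma : Measure ℝ :=
  (volume : Measure ℝ).withDensity fun y => ENNReal.ofReal (1 / bracket y)

/-- The cap `𝒞_k`, in the coordinate `y` on the hyperbola. -/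
def cap (k : ℤ) : Set ℝ :=
  Set.Ico (Real.sinh ((k : ℝ) - 1 / 2)) (Real.sinh ((k : ℝ) + 1 / 2))

/-- The character `exp (i (x y + t ⟨y⟩))`, where `z = (x, t)`. -/
def phase (z : ℝ × ℝ) (y : ℝ) : ℂ :=
  Complex.exp (Complex.I * ((z.1 * y + z.2 * bracket y : ℝ) : ℂ))

/-- The Fourier extension operator given by its integral, for `f` integrable on `ℍ¹`
(for instance for Schwartz functions):
`T f (x, t) = ∫ exp (i x y) exp (i t ⟨y⟩) f y dy / ⟨y⟩`. -/
def extensionIntegral (f : ℝ → ℂ) (z : ℝ × ℝ) : ℂ :=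
  ∫ y, phase z y * f y ∂sigma

/-- `IsExtension f F` says that `T f = F` (as functions on `ℝ²` up to null sets). For
`f ∈ L²(ℍ¹)` the integral defining `T f` need not converge absolutely, and `T f` is the
Fourier transform of the measure `f σ`, reflected through the origin, in the sense of
distributions. This is the continuous extension of `T` from Schwartz functions to `L²(ℍ¹)`. -/
def IsExtension (f : ℝ → ℂ) (F : ℝ × ℝ → ℂ) : Prop :=
  LocallyIntegrable F volume ∧
    ∀ φ : ℝ × ℝ → ℂ, ContDiff ℝ ∞ φ → HasCompactSupport φ →
      ∫ z, F z * φ z = ∫ y, f y * (∫ z, phase z y * φ z) ∂sigma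

theorem continuous_phase : Continuous fun p : (ℝ × ℝ) × ℝ => phase p.1 p.2 := by
  unfold phase bracket
  fun_prop

theorem norm_phase (z : ℝ × ℝ) (y : ℝ) : ‖phase z y‖ = 1 := by
  rw [phase, mul_comm]
  exact Complex.norm_exp_ofReal_mul_I _

instance : SFinite sigma := by
  unfold sigma
  infer_instance

/-- For `f` integrable on `ℍ¹` the integral formula gives `T f`. -/
theorem isExtension_extensionIntegral {f : ℝ → ℂ} (hf : Integrable f sigma) :
    IsExtension f (extensionIntegral f) := by
  have hc : Continuous (extensionIntegral f) := by
    refine continuous_of_dominated (bound := fun y => ‖f y‖) ?_ ?_ hf.norm ?_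
    · intro z
      refine AEStronglyMeasurable.mul ?_ hf.1
      exact (continuous_phase.comp (by fun_prop : Continuous fun y : ℝ => (z, y))).aestronglyMeasurable
    · intro z
      filter_upwards with y
      simp [norm_phase]
    · filter_upwards with y
      exact (continuous_phase.comp
        (by fun_prop : Continuous fun z : ℝ × ℝ => (z, y))).mul continuous_const
  refine ⟨hc.locallyIntegrable, fun φ hφ hs => ?_⟩
  have hφi : Integrable φ volume := hφ.continuous.integrable_of_hasCompactSupport hs
  have hint : Integrable (Function.uncurry fun (z : ℝ × ℝ) (y : ℝ) => phase z y * (φ z * f y))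
      ((volume : Measure (ℝ × ℝ)).prod sigma) := by
    have h := hφi.mul_prod hf
    refine h.mono (continuous_phase.aestronglyMeasurable.mul h.1) ?_
    filter_upwards with p
    simp [Function.uncurry, norm_phase]
  calc ∫ z, extensionIntegral f z * φ z
      = ∫ z, ∫ y, phase z y * (φ z * f y) ∂sigma := by
        refine integral_congr_ae (Filter.Eventually.of_forall fun z => ?_)
        simp only [extensionIntegral]
        rw [← integral_mul_const]
        congr 1
        ext y
        ring
    _ = ∫ y, (∫ z : ℝ × ℝ, phase z y * (φ z * f y)) ∂sigma := integral_integral_swap hint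
    _ = ∫ y, f y * (∫ z, phase z y * φ z) ∂sigma := by
        refine integral_congr_ae (Filter.Eventually.of_forall fun y => ?_)
        simp only
        rw [← integral_const_mul]
        congr 1
        ext z
        ring

/-- `T f` is unique up to null sets. -/
theorem IsExtension.ae_eq {f : ℝ → ℂ} {F G : ℝ × ℝ → ℂ} (hF : IsExtension f F)
    (hG : IsExtension f G) : F =ᵐ[volume] G := by
  refine ae_eq_of_integral_contDiff_smul_eq hF.1 hG.1 fun g hg hs => ?_
  have h1 : ContDiff ℝ ∞ fun z => ((g z : ℝ) : ℂ) := Complex.ofRealCLM.contDiff.comp hg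
  have h2 : HasCompactSupport fun z => ((g z : ℝ) : ℂ) :=
    hs.comp_left (g := fun r : ℝ => (r : ℂ)) Complex.ofReal_zero
  have h := (hF.2 _ h1 h2).trans (hG.2 _ h1 h2).symm
  simpa [mul_comm] using h

end Hyperbola

end

open MeasureTheory
open scoped ENNReal NNReal ContDiff

noncomputable section

namespace Hyperbola

open scoped FourierTransform SchwartzMap

/-! In the coordinate `u = arsinh y` the measure `σ` becomes Lebesgue measure and the caps become
unit intervals centred at the integers. For `g`, `h` integrable in `u`, the product `Tg · Th` is one
oscillatory integral over pairs `(u, v)`, with frequency the sum of two points of the hyperbola. The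
sum map is injective on each side of the diagonal and has Jacobian `|sinh (u - v)|`. So, relative to
the measure `|sinh (u - v)| du dv` and the density `g(u) h(v) / |sinh (u - v)|`, the operator is
bounded on `L²` by Plancherel and duality (`lintegral_pairMeasure_fourier_sq_le`,
`lintegral_enorm_oscillatory_sq_le`) and trivially from `L¹` to `L^∞`.

Interpolation (`lintegral_enorm_oscillatory_rpow_le`) gives, for `q > 2` and `q' = q/(q-1)`, control
of `‖Tg · Th‖_q` by the double integral of `|g|^q' |h|^q' |sinh (u - v)|^(1-q')`. On caps `j`, `k`
the kernel is at most an exponentially small factor in `|j - k|` times a Riesz kernel. The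
Hardy–Littlewood–Sobolev inequality then yields a bilinear estimate in `L^r`, `r = 2q/(2q-3)`, with
decay `exp (-|j-k|/(2q))` (`exists_eLpNorm_waveIntegral_mul_le`).

To sum over caps, use `‖Tf‖_{2q}³ = ‖(Tf)³‖_{2q/3}`, expand the cube, apply Hölder to each triple of
caps through its three pairs, and sum by Schur's test (`sum_trilinear_le`). This produces the `ℓ³`
norm over caps.

For `q = 3` one has `r = 2`, so truncations of an `L²` function to finitely many caps have
extensions that are Cauchy in `L⁶`. Their limit is `Tf`, and Fatou's lemma transfers every other
`L^{2q}` bound to it. The cap bound follows with `p = 2q`: since `r ≤ 2` and the caps have measure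
one, local `L^r` norms are at most local `L²` norms, and the `ℓ³` norm is at most `(sup)^{1/3}
(ℓ²)^{2/3}`. -/

theorem eLpNorm_two_sq_eq_lintegral {X : Type*} [MeasurableSpace X] {μ : Measure X} (g : X → ℂ) :
    eLpNorm g 2 μ ^ 2 = ∫⁻ x, ‖g x‖ₑ ^ 2 ∂μ := by
  have := eLpNorm_nnreal_pow_eq_lintegral (μ := μ) (f := g) (p := 2) (by simp)
  simpa only [NNReal.coe_ofNat, ENNReal.rpow_ofNat, ENNReal.coe_ofNat] using this

/-! ### Plancherel's theorem for the Fourier integral. -/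

section Plancherel

variable {E : Type*} [NormedAddCommGroup E] [InnerProductSpace ℝ E] [FiniteDimensional ℝ E]
  [MeasurableSpace E] [BorelSpace E]

/-- The Fourier transform on `L²` is given by the Fourier integral on `L¹ ∩ L²`. -/
theorem fourier_toLp_ae_eq {f : E → ℂ} (h1 : Integrable f) (h2 : MemLp f 2) :
    (𝓕 (h2.toLp f) : Lp ℂ 2 (volume : Measure E)) =ᵐ[volume] 𝓕 f := by
  have hc : Continuous (𝓕 f) :=
    VectorFourier.fourierIntegral_continuous Real.continuous_fourierChar
      (by exact continuous_inner) h1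
  have hl : LocallyIntegrable (𝓕 (h2.toLp f) : Lp ℂ 2 (volume : Measure E)) :=
    (Lp.memLp _).locallyIntegrable (by norm_num)
  refine ae_eq_of_integral_contDiff_smul_eq hl hc.locallyIntegrable fun g hg hs => ?_
  have hg1 : ContDiff ℝ ∞ fun z => ((g z : ℝ) : ℂ) := Complex.ofRealCLM.contDiff.comp hg
  have hs1 : HasCompactSupport fun z => ((g z : ℝ) : ℂ) :=
    hs.comp_left (g := fun r : ℝ => (r : ℂ)) Complex.ofReal_zero
  set s : 𝓢(E, ℂ) := hs1.toSchwartzMap hg1 with hsdef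
  have hsg : ∀ x, s x = ((g x : ℝ) : ℂ) := fun x => rfl
  -- Both transforms move onto the test function: the `L²` one by its compatibility with tempered
  -- distributions, the `L¹` one by Fubini.
  have h := congrArg (fun T => T s) (Lp.fourier_toTemperedDistribution_eq (h2.toLp f))
  simp only [TemperedDistribution.fourier_apply, Lp.toTemperedDistribution_apply] at h
  have e1 : ∫ x, g x • (𝓕 (h2.toLp f) : Lp ℂ 2 (volume : Measure E)) x
      = ∫ x, s x • (𝓕 (h2.toLp f) : Lp ℂ 2 (volume : Measure E)) x := by
    refine integral_congr_ae (Filter.Eventually.of_forall fun x => ?_)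
    simp [hsg]
  have e2 : ∫ x, g x • 𝓕 f x = ∫ x, s x • 𝓕 f x := by
    refine integral_congr_ae (Filter.Eventually.of_forall fun x => ?_)
    simp [hsg]
  rw [e1, e2, ← h]
  have e3 : ∫ x, (𝓕 s) x • (h2.toLp f) x = ∫ x, (𝓕 s) x • f x := by
    refine integral_congr_ae ?_
    filter_upwards [h2.coeFn_toLp] with x hx
    rw [hx]
  rw [e3]
  have h4 := VectorFourier.integral_fourierIntegral_smul_eq_flip (μ := (volume : Measure E))
    (ν := (volume : Measure E)) (L := innerₗ E) Real.continuous_fourierChar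
    (by exact continuous_inner) (s.integrable) h1
  rw [flip_innerₗ] at h4
  exact h4

theorem lintegral_enorm_fourier_sq {f : E → ℂ} (h1 : Integrable f) (h2 : MemLp f 2) :
    ∫⁻ ξ, ‖𝓕 f ξ‖ₑ ^ 2 = ∫⁻ x, ‖f x‖ₑ ^ 2 := by
  have h : eLpNorm (𝓕 f) 2 volume = eLpNorm f 2 volume := by
    rw [← eLpNorm_congr_ae (fourier_toLp_ae_eq h1 h2), ← eLpNorm_congr_ae h2.coeFn_toLp]
    have := Lp.norm_fourier_eq (h2.toLp f)
    rw [Lp.norm_def, Lp.norm_def, ENNReal.toReal_eq_toReal_iff' (Lp.eLpNorm_ne_top _)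
      (Lp.eLpNorm_ne_top _)] at this
    exact this
  rw [← eLpNorm_two_sq_eq_lintegral, ← eLpNorm_two_sq_eq_lintegral, h]

end Plancherel

/-- Plancherel's theorem on `ℝ × ℝ`. -/
theorem lintegral_enorm_fourierIntegral_prod_sq {f : ℝ × ℝ → ℂ} (h1 : Integrable f)
    (h2 : MemLp f 2) :
    ∫⁻ ξ : ℝ × ℝ, ‖∫ z : ℝ × ℝ,
        Complex.exp (((-2 * Real.pi * (z.1 * ξ.1 + z.2 * ξ.2) : ℝ) : ℂ) * Complex.I) * f z‖ₑ ^ 2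
      = ∫⁻ z, ‖f z‖ₑ ^ 2 := by
  -- The type `ℝ × ℝ` carries the sup norm, so the inner product structure is borrowed from `WithLp
  -- 2`, which has the same volume.
  have mp : MeasurePreserving (@WithLp.ofLp 2 (ℝ × ℝ)) :=
    WithLp.volume_preserving_ofLp ℝ ℝ
  have me : MeasurableEmbedding (@WithLp.ofLp 2 (ℝ × ℝ)) :=
    (MeasurableEquiv.toLp 2 (ℝ × ℝ)).symm.measurableEmbedding
  have H := lintegral_enorm_fourier_sq (E := WithLp 2 (ℝ × ℝ)) (f := f ∘ WithLp.ofLp)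
    ((mp.integrable_comp_emb me).2 h1) (h2.comp_measurePreserving mp)
  rw [← mp.lintegral_comp_emb me, ← mp.lintegral_comp_emb me (fun z => ‖f z‖ₑ ^ 2)]
  refine Eq.trans ?_ H
  refine lintegral_congr fun ξ => ?_
  congr 2
  rw [Real.fourier_eq', ← mp.integral_comp me]
  refine integral_congr_ae (Filter.Eventually.of_forall fun z => ?_)
  simp only [Function.comp_apply, smul_eq_mul, WithLp.prod_inner_apply, RCLike.inner_apply,
    conj_trivial]
  congr 4
  simp [mul_comm]

/-! ### Sums of two points of the hyperbola as a change of variables. -/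

/-- The character `exp (i (x sinh u + t cosh u))`: `phase` in the coordinate `u = arsinh y`. -/
def wave (z : ℝ × ℝ) (u : ℝ) : ℂ :=
  Complex.exp (((z.1 * Real.sinh u + z.2 * Real.cosh u : ℝ) : ℂ) * Complex.I)

theorem continuous_wave : Continuous fun p : (ℝ × ℝ) × ℝ => wave p.1 p.2 := by
  unfold wave
  fun_prop

theorem norm_wave (z : ℝ × ℝ) (u : ℝ) : ‖wave z u‖ = 1 :=
  Complex.norm_exp_ofReal_mul_I _

theorem bracket_sinh (u : ℝ) : bracket (Real.sinh u) = Real.cosh u := by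
  rw [bracket, add_comm, ← Real.cosh_sq, Real.sqrt_sq (Real.cosh_pos u).le]

theorem phase_sinh (z : ℝ × ℝ) (u : ℝ) : phase z (Real.sinh u) = wave z u := by
  rw [phase, wave, bracket_sinh, mul_comm]

/-- The sum of two points of the hyperbola, scaled by `-1 / (2π)`. -/
def sumMap (p : ℝ × ℝ) : ℝ × ℝ :=
  (-(1 / (2 * Real.pi)) * (Real.sinh p.1 + Real.sinh p.2),
    -(1 / (2 * Real.pi)) * (Real.cosh p.1 + Real.cosh p.2))

/-- The derivative of `sumMap`. -/
def sumMapDeriv (p : ℝ × ℝ) : ℝ × ℝ →L[ℝ] ℝ × ℝ :=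
  (LinearMap.toContinuousLinearMap (Matrix.toLin (Module.Basis.finTwoProd ℝ)
    (Module.Basis.finTwoProd ℝ)
    !![-(1 / (2 * Real.pi)) * Real.cosh p.1, -(1 / (2 * Real.pi)) * Real.cosh p.2;
       -(1 / (2 * Real.pi)) * Real.sinh p.1, -(1 / (2 * Real.pi)) * Real.sinh p.2]))

theorem hasFDerivAt_sumMap (p : ℝ × ℝ) : HasFDerivAt sumMap (sumMapDeriv p) p := by
  rw [sumMapDeriv, Matrix.toLin_finTwoProd_toContinuousLinearMap]
  have h1 : HasFDerivAt (fun p : ℝ × ℝ => p.1) (ContinuousLinearMap.fst ℝ ℝ ℝ) p := hasFDerivAt_fst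
  have h2 : HasFDerivAt (fun p : ℝ × ℝ => p.2) (ContinuousLinearMap.snd ℝ ℝ ℝ) p := hasFDerivAt_snd
  have key := ((h1.sinh.add h2.sinh).const_mul (-(1 / (2 * Real.pi)))).prodMk
    ((h1.cosh.add h2.cosh).const_mul (-(1 / (2 * Real.pi))))
  convert! key using 1
  simp only [smul_add, smul_smul]

theorem abs_det_sumMapDeriv (p : ℝ × ℝ) :
    |(sumMapDeriv p).det| = (1 / (2 * Real.pi)) ^ 2 * |Real.sinh (p.1 - p.2)| := by
  rw [ContinuousLinearMap.det, sumMapDeriv, LinearMap.coe_toContinuousLinearMap,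
    LinearMap.det_toLin, Matrix.det_fin_two_of, ← abs_of_nonneg (sq_nonneg (1 / (2 * Real.pi))),
    ← abs_mul, ← abs_neg, Real.sinh_sub]
  congr 1
  ring

/-- Adding and subtracting the two coordinates gives `e^u + e^v` and `e^(-u) + e^(-v)`. Their
quotient is `e^u e^v`, so the unordered pair of exponentials is determined as the roots of a
quadratic, and `v < u` fixes the order. -/
theorem injOn_sumMap : Set.InjOn sumMap {p | p.2 < p.1} := by
  rintro ⟨u, v⟩ huv ⟨u', v'⟩ huv' h
  simp only [Set.mem_ofPred_eq] at huv huv'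
  have hpi : -(1 / (2 * Real.pi)) ≠ 0 := neg_ne_zero.2 (by positivity)
  obtain ⟨h1, h2⟩ := Prod.mk.inj h
  replace h1 := mul_left_cancel₀ hpi h1
  replace h2 := mul_left_cancel₀ hpi h2
  simp only [Real.sinh_eq, Real.cosh_eq] at h1 h2
  have hs : Real.exp u + Real.exp v = Real.exp u' + Real.exp v' := by linarith
  have hd : Real.exp (-u) + Real.exp (-v) = Real.exp (-u') + Real.exp (-v') := by linarith
  have hp : Real.exp u * Real.exp v = Real.exp u' * Real.exp v' := by
    have a := Real.exp_pos u
    have b := Real.exp_pos v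
    have c := Real.exp_pos u'
    have d := Real.exp_pos v'
    rw [Real.exp_neg, Real.exp_neg, Real.exp_neg, Real.exp_neg] at hd
    field_simp at hd
    have : (Real.exp u + Real.exp v) * (Real.exp u' * Real.exp v')
        = (Real.exp u + Real.exp v) * (Real.exp u * Real.exp v) := by
      linear_combination hd - Real.exp u * Real.exp v * hs
    exact (mul_left_cancel₀ (by positivity) this).symm
  have hu : (Real.exp u - Real.exp u') * (Real.exp u - Real.exp v') = 0 := by
    linear_combination Real.exp u * hs - hp
  have l1 := Real.exp_lt_exp.2 huv
  have l2 := Real.exp_lt_exp.2 huv'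
  rcases mul_eq_zero.1 hu with h0 | h0
  · have e1 : Real.exp u = Real.exp u' := by linarith
    have e2 : Real.exp v = Real.exp v' := by linarith
    rw [Real.exp_eq_exp.1 e1, Real.exp_eq_exp.1 e2]
  · linarith

theorem injOn_sumMap_swap : Set.InjOn sumMap {p | p.1 < p.2} := by
  intro p hp p' hp' h
  have hsw : ∀ p : ℝ × ℝ, sumMap p.swap = sumMap p := fun p => by
    simp only [sumMap, Prod.fst_swap, Prod.snd_swap, add_comm]
  exact Prod.swap_injective (injOn_sumMap (show p.swap ∈ {p : ℝ × ℝ | p.2 < p.1} from hp)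
    (show p'.swap ∈ {p : ℝ × ℝ | p.2 < p.1} from hp') (by rw [hsw, hsw, h]))

theorem lintegral_sumMap_le {s : Set (ℝ × ℝ)} (hs : MeasurableSet s) (hinj : Set.InjOn sumMap s)
    (g : ℝ × ℝ → ℝ≥0∞) :
    ∫⁻ p in s, ENNReal.ofReal |Real.sinh (p.1 - p.2)| * g (sumMap p)
      ≤ ENNReal.ofReal ((2 * Real.pi) ^ 2) * ∫⁻ ξ, g ξ := by
  have h := lintegral_image_eq_lintegral_abs_det_fderiv_mul volume hs
    (fun p _ => (hasFDerivAt_sumMap p).hasFDerivWithinAt) hinj g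
  have e : ∀ p : ℝ × ℝ, ENNReal.ofReal |Real.sinh (p.1 - p.2)| * g (sumMap p)
      = ENNReal.ofReal ((2 * Real.pi) ^ 2) *
        (ENNReal.ofReal |(sumMapDeriv p).det| * g (sumMap p)) := by
    intro p
    rw [← mul_assoc, ← ENNReal.ofReal_mul (by positivity), abs_det_sumMapDeriv, ← mul_assoc,
      ← mul_pow, mul_one_div_cancel (by positivity), one_pow, one_mul]
  simp only [e]
  rw [lintegral_const_mul' _ _ ENNReal.ofReal_ne_top, ← h]
  gcongr
  exact Measure.restrict_le_self

/-- The measure `|sinh (u - v)| du dv`. -/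
def pairMeasure : Measure (ℝ × ℝ) :=
  (volume : Measure (ℝ × ℝ)).withDensity fun p => ENNReal.ofReal |Real.sinh (p.1 - p.2)|

instance : SFinite pairMeasure := by
  unfold pairMeasure
  infer_instance

theorem measurable_pairDensity :
    Measurable fun p : ℝ × ℝ => ENNReal.ofReal |Real.sinh (p.1 - p.2)| := by
  fun_prop

/-- The product of the characters of two points of the hyperbola. -/
def wavePair (z : ℝ × ℝ) (p : ℝ × ℝ) : ℂ := wave z p.1 * wave z p.2

theorem continuous_wavePair : Continuous fun p : (ℝ × ℝ) × (ℝ × ℝ) => wavePair p.1 p.2 := by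
  unfold wavePair wave
  fun_prop

theorem norm_wavePair (z p : ℝ × ℝ) : ‖wavePair z p‖ = 1 := by
  rw [wavePair, norm_mul, norm_wave, norm_wave, one_mul]

/-- The factor `-1/(2π)` in `sumMap` is there so that the product of two characters is exactly the
Fourier kernel at `sumMap p`. -/
theorem wavePair_eq (z p : ℝ × ℝ) :
    wavePair z p = Complex.exp (((-2 * Real.pi *
      (z.1 * (sumMap p).1 + z.2 * (sumMap p).2) : ℝ) : ℂ) * Complex.I) := by
  rw [wavePair, wave, wave, ← Complex.exp_add, ← add_mul, ← Complex.ofReal_add]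
  congr 3
  simp only [sumMap]
  field_simp
  ring

/-- The integrand is `|ψ̂|²` at `sumMap p`, and the density of `pairMeasure` is the Jacobian up to
`(2π)²`. Each open half plane off the diagonal contributes at most one full Plancherel integral,
hence the factor 2; on the diagonal the density vanishes. -/
theorem lintegral_pairMeasure_fourier_sq_le {ψ : ℝ × ℝ → ℂ} (h1 : Integrable ψ)
    (h2 : MemLp ψ 2) :
    ∫⁻ p, ‖∫ z, wavePair z p * ψ z‖ₑ ^ 2 ∂pairMeasure
      ≤ 2 * ENNReal.ofReal ((2 * Real.pi) ^ 2) * ∫⁻ z, ‖ψ z‖ₑ ^ 2 := by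
  set g : ℝ × ℝ → ℝ≥0∞ := fun ξ => ‖∫ z : ℝ × ℝ,
        Complex.exp (((-2 * Real.pi * (z.1 * ξ.1 + z.2 * ξ.2) : ℝ) : ℂ) * Complex.I) * ψ z‖ₑ ^ 2
    with hg
  have e : ∀ p, ‖∫ z, wavePair z p * ψ z‖ₑ ^ 2 = g (sumMap p) := by
    intro p
    simp only [wavePair_eq, hg]
  rw [← lintegral_enorm_fourierIntegral_prod_sq h1 h2, pairMeasure,
    lintegral_withDensity_eq_lintegral_mul_non_measurable _ measurable_pairDensity
      (Filter.Eventually.of_forall fun _ => ENNReal.ofReal_lt_top)]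
  simp only [e, Pi.mul_apply]
  have hm1 : MeasurableSet {p : ℝ × ℝ | p.2 < p.1} := measurableSet_lt measurable_snd measurable_fst
  have hm2 : MeasurableSet {p : ℝ × ℝ | p.1 < p.2} := measurableSet_lt measurable_fst measurable_snd
  have hm3 : MeasurableSet {p : ℝ × ℝ | p.1 = p.2} := measurableSet_eq_fun measurable_fst measurable_snd
  have hz : ∫⁻ p in {p : ℝ × ℝ | p.1 = p.2},
      ENNReal.ofReal |Real.sinh (p.1 - p.2)| * g (sumMap p) = 0 := by
    rw [setLIntegral_congr_fun hm3 (g := fun _ => 0)]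
    · simp
    · intro p hp
      simp [show p.1 = p.2 from hp]
  have hun : (Set.univ : Set (ℝ × ℝ)) =
      ({p : ℝ × ℝ | p.2 < p.1} ∪ {p : ℝ × ℝ | p.1 < p.2}) ∪ {p : ℝ × ℝ | p.1 = p.2} := by
    ext p
    simp only [Set.mem_univ, Set.mem_union, Set.mem_ofPred_eq, true_iff]
    rcases lt_trichotomy p.1 p.2 with h | h | h <;> simp [h]
  rw [← setLIntegral_univ, hun]
  refine (lintegral_union_le _ _ _).trans ?_
  rw [hz, add_zero]
  refine (lintegral_union_le _ _ _).trans ?_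
  rw [mul_assoc, two_mul]
  exact add_le_add (lintegral_sumMap_le hm1 injOn_sumMap g)
    (lintegral_sumMap_le hm2 injOn_sumMap_swap g)

/-! ### Oscillatory integral operators: transposes and `L²` duality. -/

section Oscillatory

variable {X Z : Type*} [MeasurableSpace X] {μ : Measure X} {e : Z → X → ℂ}

theorem enorm_integral_mul_le (he : ∀ z x, ‖e z x‖ ≤ 1) (G : X → ℂ) (z : Z) :
    ‖∫ x, e z x * G x ∂μ‖ₑ ≤ ∫⁻ x, ‖G x‖ₑ ∂μ := by
  refine (enorm_integral_le_lintegral_enorm _).trans (lintegral_mono fun x => ?_)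
  rw [enorm_mul]
  refine mul_le_of_le_one_left (by positivity) ?_
  rw [← ofReal_norm]
  exact ENNReal.ofReal_le_one.2 (he z x)

theorem integrable_mul_of_bounded [MeasurableSpace Z] (hm : Measurable (Function.uncurry e))
    (he : ∀ z x, ‖e z x‖ ≤ 1) {G : X → ℂ} (hG : Integrable G μ) (z : Z) :
    Integrable (fun x => e z x * G x) μ :=
  hG.bdd_mul (c := 1) (hm.comp (by fun_prop : Measurable fun x : X => (z, x))).aestronglyMeasurable
    (Filter.Eventually.of_forall (he z))

/-- The transpose of an oscillatory integral operator. -/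
theorem integral_oscillatory_mul [MeasurableSpace Z] {ν : Measure Z} [SFinite μ] [SFinite ν]
    (hm : Measurable (Function.uncurry e)) (he : ∀ z x, ‖e z x‖ ≤ 1) {G : X → ℂ}
    (hG : Integrable G μ) {ψ : Z → ℂ} (hψ : Integrable ψ ν) :
    ∫ z, (∫ x, e z x * G x ∂μ) * ψ z ∂ν = ∫ x, G x * (∫ z, e z x * ψ z ∂ν) ∂μ := by
  have hint : Integrable (Function.uncurry fun (z : Z) (x : X) => e z x * (ψ z * G x))
      (ν.prod μ) :=
    (hψ.mul_prod hG).bdd_mul (c := 1) hm.aestronglyMeasurable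
      (Filter.Eventually.of_forall fun p => he p.1 p.2)
  calc ∫ z, (∫ x, e z x * G x ∂μ) * ψ z ∂ν = ∫ z, ∫ x, e z x * (ψ z * G x) ∂μ ∂ν := by
        refine integral_congr_ae (Filter.Eventually.of_forall fun z => ?_)
        simp only
        rw [← integral_mul_const]
        refine integral_congr_ae (Filter.Eventually.of_forall fun x => ?_)
        simp only
        ring
    _ = ∫ x, ∫ z, e z x * (ψ z * G x) ∂ν ∂μ := integral_integral_swap hint
    _ = _ := by
        refine integral_congr_ae (Filter.Eventually.of_forall fun x => ?_)
        simp only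
        rw [← integral_const_mul]
        refine integral_congr_ae (Filter.Eventually.of_forall fun z => ?_)
        simp only
        ring

/-- An `L²` bound for the transpose of an oscillatory integral operator gives one for the
operator. -/
theorem lintegral_enorm_oscillatory_sq_le [MeasurableSpace Z] {ν : Measure Z}
    [SFinite μ] [SigmaFinite ν] {K : ℝ≥0∞}
    (hm : Measurable (Function.uncurry e))
    (he : ∀ z x, ‖e z x‖ ≤ 1)
    (hK : ∀ ψ : Z → ℂ, Integrable ψ ν → MemLp ψ 2 ν →
      ∫⁻ x, ‖∫ z, e z x * ψ z ∂ν‖ₑ ^ 2 ∂μ ≤ K * ∫⁻ z, ‖ψ z‖ₑ ^ 2 ∂ν)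
    {G : X → ℂ} (hG : Integrable G μ) :
    ∫⁻ z, ‖∫ x, e z x * G x ∂μ‖ₑ ^ 2 ∂ν ≤ K * ∫⁻ x, ‖G x‖ₑ ^ 2 ∂μ := by
  set S : Z → ℂ := fun z => ∫ x, e z x * G x ∂μ with hS
  have hSm : AEStronglyMeasurable S ν :=
    (hm.aestronglyMeasurable.mul hG.1.comp_snd :
      AEStronglyMeasurable (fun p : Z × X => e p.1 p.2 * G p.2) (ν.prod μ)).integral_prod_right'
  have hSb : ∀ z, ‖S z‖ ≤ ∫ x, ‖G x‖ ∂μ := fun z => by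
    refine (norm_integral_le_integral_norm _).trans (integral_mono_of_nonneg
      (Filter.Eventually.of_forall fun _ => norm_nonneg _) hG.norm
      (Filter.Eventually.of_forall fun x => ?_))
    simp only [norm_mul]
    exact mul_le_of_le_one_left (norm_nonneg _) (he z x)
  have key : ∀ n, ∫⁻ z in spanningSets ν n, ‖S z‖ₑ ^ 2 ∂ν ≤ K * ∫⁻ x, ‖G x‖ₑ ^ 2 ∂μ := by
    intro n
    set B := spanningSets ν n
    have hB : MeasurableSet B := measurableSet_spanningSets ν n
    have hBf : ν B < ⊤ := measure_spanningSets_lt_top ν n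
    have : IsFiniteMeasure (ν.restrict B) := ⟨by simpa using hBf⟩
    set M := ∫⁻ z in B, ‖S z‖ₑ ^ 2 ∂ν with hM
    set N := ∫⁻ x, ‖G x‖ₑ ^ 2 ∂μ with hN
    -- Testing `S` against its own conjugate on a set of finite measure makes the pairing equal to
    -- `M`. Since `S` is bounded, `ψ` lies in every `L^p` and `M` is finite, so that `M` may be
    -- cancelled at the end.
    set ψ : Z → ℂ := B.indicator fun z => (starRingEnd ℂ) (S z) with hψ
    have hcm : AEStronglyMeasurable (fun z => (starRingEnd ℂ) (S z)) ν :=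
      Complex.continuous_conj.comp_aestronglyMeasurable hSm
    have hψp : ∀ p, MemLp ψ p ν := fun p => by
      refine (memLp_indicator_iff_restrict hB).2 ?_
      refine MemLp.of_bound hcm.restrict (∫ x, ‖G x‖ ∂μ) (Filter.Eventually.of_forall fun z => ?_)
      simpa using hSb z
    have hψi : Integrable ψ ν := memLp_one_iff_integrable.1 (hψp 1)
    have hψM : ∫⁻ z, ‖ψ z‖ₑ ^ 2 ∂ν = M := by
      rw [hM, ← lintegral_indicator hB]
      refine lintegral_congr fun z => ?_
      by_cases hz : z ∈ B
      · simp only [hψ, Set.indicator_of_mem hz, ← ofReal_norm, RCLike.norm_conj]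
      · simp [hψ, hz]
    have hMtop : M ≠ ⊤ := by
      have h2 := (hψp 2).2
      rw [← hψM]
      rw [← eLpNorm_two_sq_eq_lintegral]
      exact (ENNReal.pow_lt_top h2).ne
    have hpair : ‖∫ z, S z * ψ z ∂ν‖ₑ = M := by
      have e1 : ∫ z, S z * ψ z ∂ν = ((∫ z, ‖ψ z‖ ^ 2 ∂ν : ℝ) : ℂ) := by
        rw [← integral_complex_ofReal]
        refine integral_congr_ae (Filter.Eventually.of_forall fun z => ?_)
        by_cases hz : z ∈ B
        · simp [hψ, hz, Complex.mul_conj, Complex.normSq_eq_norm_sq]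
        · simp [hψ, hz]
      rw [e1, ← ofReal_norm, Complex.norm_real, Real.norm_of_nonneg (by positivity),
        ofReal_integral_eq_lintegral_ofReal ((hψp 2).integrable_norm_pow (by norm_num))
          (Filter.Eventually.of_forall fun _ => by positivity), ← hψM]
      refine lintegral_congr fun z => ?_
      rw [ENNReal.ofReal_pow (norm_nonneg _), ofReal_norm]
    have hswap : ∫ z, S z * ψ z ∂ν = ∫ x, G x * (∫ z, e z x * ψ z ∂ν) ∂μ :=
      integral_oscillatory_mul hm he hG hψi
    have hTm : AEStronglyMeasurable (fun x => ∫ z, e z x * ψ z ∂ν) μ :=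
      ((hm.comp measurable_swap).aestronglyMeasurable.mul hψi.1.comp_snd :
        AEStronglyMeasurable (fun p : X × Z => e p.2 p.1 * ψ p.2) (μ.prod ν)).integral_prod_right'
    have hle : M ≤ N ^ (1 / 2 : ℝ) * (K * M) ^ (1 / 2 : ℝ) := by
      calc M = ‖∫ x, G x * (∫ z, e z x * ψ z ∂ν) ∂μ‖ₑ := by rw [← hswap, hpair]
        _ ≤ ∫⁻ x, ‖G x‖ₑ * ‖∫ z, e z x * ψ z ∂ν‖ₑ ∂μ := by
            refine (enorm_integral_le_lintegral_enorm _).trans_eq ?_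
            simp only [enorm_mul]
        _ ≤ (∫⁻ x, ‖G x‖ₑ ^ (2 : ℝ) ∂μ) ^ (1 / 2 : ℝ) *
            (∫⁻ x, ‖∫ z, e z x * ψ z ∂ν‖ₑ ^ (2 : ℝ) ∂μ) ^ (1 / 2 : ℝ) :=
            ENNReal.lintegral_mul_le_Lp_mul_Lq μ Real.HolderConjugate.two_two hG.1.enorm hTm.enorm
        _ ≤ N ^ (1 / 2 : ℝ) * (K * M) ^ (1 / 2 : ℝ) := by
            simp only [ENNReal.rpow_ofNat]
            rw [← hψM]
            gcongr
            exact hK ψ hψi (hψp 2)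
    have hsq : M * M ≤ (K * N) * M := by
      calc M * M ≤ (N ^ (1 / 2 : ℝ) * (K * M) ^ (1 / 2 : ℝ)) *
            (N ^ (1 / 2 : ℝ) * (K * M) ^ (1 / 2 : ℝ)) := mul_le_mul' hle hle
        _ = (N ^ (1 / 2 : ℝ) * N ^ (1 / 2 : ℝ)) * ((K * M) ^ (1 / 2 : ℝ) * (K * M) ^ (1 / 2 : ℝ)) := by
            ring
        _ = (K * N) * M := by
            rw [← ENNReal.rpow_add_of_nonneg _ _ (by norm_num) (by norm_num),
              ← ENNReal.rpow_add_of_nonneg _ _ (by norm_num) (by norm_num)]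
            norm_num
            ring
    rcases eq_or_ne M 0 with h0 | h0
    · rw [h0]; exact zero_le
    · exact (ENNReal.mul_le_mul_iff_left h0 hMtop).1 hsq
  calc ∫⁻ z, ‖S z‖ₑ ^ 2 ∂ν = ⨆ n, ∫⁻ z in spanningSets ν n, ‖S z‖ₑ ^ 2 ∂ν := by
        rw [← setLIntegral_univ, ← iUnion_spanningSets ν]
        exact setLIntegral_iUnion_of_directed _ (monotone_spanningSets ν).directed_le
    _ ≤ _ := iSup_le key

end Oscillatory

theorem lintegral_Ioo_rpow {s b : ℝ} (hs : -1 < s) (hb : 0 ≤ b) :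
    ∫⁻ t in Set.Ioo 0 b, ENNReal.ofReal (t ^ s) = ENNReal.ofReal (b ^ (s + 1) / (s + 1)) := by
  rw [← ofReal_integral_eq_lintegral_ofReal]
  · congr 1
    rw [← integral_Ioc_eq_integral_Ioo, ← intervalIntegral.integral_of_le hb,
      integral_rpow (Or.inl hs), Real.zero_rpow (by linarith), sub_zero]
  · exact ((intervalIntegral.intervalIntegrable_rpow' hs).1).mono_set Set.Ioo_subset_Ioc_self
  · filter_upwards [self_mem_ae_restrict measurableSet_Ioo] with t ht
    exact Real.rpow_nonneg ht.1.le _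

/-! ### The Hausdorff–Young inequality by real interpolation. -/

section Oscillatory

variable {X Z : Type*} [MeasurableSpace X] [MeasurableSpace Z] {μ : Measure X} {ν : Measure Z}
  [SFinite μ] {e : Z → X → ℂ} {K : ℝ≥0∞}

/-- The part of `G` off `A` contributes at most `t/2` everywhere by the trivial `L¹`–`L^∞` bound. So
the part on `A` must exceed `t/2`, and Chebyshev with the `L²` bound applies; the 4 is `(1/2)^(-2)`.
-/
theorem measure_lt_norm_oscillatory_le (hm : Measurable (Function.uncurry e))
    (he : ∀ z x, ‖e z x‖ ≤ 1)
    (hL : ∀ G : X → ℂ, Integrable G μ →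
      ∫⁻ z, ‖∫ x, e z x * G x ∂μ‖ₑ ^ 2 ∂ν ≤ K * ∫⁻ x, ‖G x‖ₑ ^ 2 ∂μ)
    {G : X → ℂ} (hG : Integrable G μ) {A : Set X} (hA : MeasurableSet A) {t : ℝ} (ht : 0 < t)
    (hAt : ∫⁻ x in Aᶜ, ‖G x‖ₑ ∂μ ≤ ENNReal.ofReal (t / 2)) :
    ν {z | t < ‖∫ x, e z x * G x ∂μ‖}
      ≤ ENNReal.ofReal (4 * t ^ (-2 : ℝ)) * (K * ∫⁻ x in A, ‖G x‖ₑ ^ 2 ∂μ) := by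
  have hGA : Integrable (A.indicator G) μ := hG.indicator hA
  have hGB : Integrable (Aᶜ.indicator G) μ := hG.indicator hA.compl
  have hsplit : ∀ z, ∫ x, e z x * G x ∂μ
      = ∫ x, e z x * A.indicator G x ∂μ + ∫ x, e z x * Aᶜ.indicator G x ∂μ := fun z => by
    rw [← integral_add (integrable_mul_of_bounded hm he hGA z)
      (integrable_mul_of_bounded hm he hGB z)]
    refine integral_congr_ae (Filter.Eventually.of_forall fun x => ?_)
    simp only
    rw [← mul_add, Set.indicator_self_add_compl_apply]
  have hsmall : ∀ z, ‖∫ x, e z x * Aᶜ.indicator G x ∂μ‖ ≤ t / 2 := fun z => by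
    have h := enorm_integral_mul_le (μ := μ) he (Aᶜ.indicator G) z
    simp only [enorm_indicator_eq_indicator_enorm] at h
    rw [lintegral_indicator hA.compl, ← ofReal_norm] at h
    exact (ENNReal.ofReal_le_ofReal_iff (by positivity)).1 (h.trans hAt)
  have hsub : {z | t < ‖∫ x, e z x * G x ∂μ‖} ⊆
      {z | ENNReal.ofReal (t / 2) ^ 2 ≤ ‖∫ x, e z x * A.indicator G x ∂μ‖ₑ ^ 2} := fun z hz => by
    simp only [Set.mem_ofPred_eq] at hz ⊢
    rw [hsplit z] at hz
    rw [← ofReal_norm]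
    gcongr
    have := norm_add_le (∫ x, e z x * A.indicator G x ∂μ) (∫ x, e z x * Aᶜ.indicator G x ∂μ)
    linarith [hsmall z]
  have hSm : AEMeasurable (fun z => ‖∫ x, e z x * A.indicator G x ∂μ‖ₑ ^ 2) ν :=
    ((hm.aestronglyMeasurable.mul hGA.1.comp_snd :
      AEStronglyMeasurable (fun p : Z × X => e p.1 p.2 * A.indicator G p.2)
        (ν.prod μ)).integral_prod_right').enorm.pow_const 2
  have hne : ENNReal.ofReal (t / 2) ^ 2 ≠ 0 := by
    simpa using ht
  calc ν {z | t < ‖∫ x, e z x * G x ∂μ‖}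
      ≤ (∫⁻ z, ‖∫ x, e z x * A.indicator G x ∂μ‖ₑ ^ 2 ∂ν) / ENNReal.ofReal (t / 2) ^ 2 :=
        (measure_mono hsub).trans
          (meas_ge_le_lintegral_div hSm hne (ENNReal.pow_ne_top ENNReal.ofReal_ne_top))
    _ ≤ (K * ∫⁻ x in A, ‖G x‖ₑ ^ 2 ∂μ) / ENNReal.ofReal (t / 2) ^ 2 := by
        gcongr
        refine (hL _ hGA).trans_eq ?_
        rw [← lintegral_indicator hA]
        congr 2
        funext x
        by_cases hx : x ∈ A <;> simp [hx]
    _ = _ := by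
        rw [ENNReal.div_eq_inv_mul, ← ENNReal.ofReal_pow (by positivity),
          ← ENNReal.ofReal_inv_of_pos (by positivity)]
        congr 2
        rw [Real.rpow_neg ht.le]
        norm_num
        field_simp
        norm_num

/-- The Hausdorff–Young inequality for an oscillatory integral operator that is bounded
on `L²`. -/
theorem lintegral_enorm_oscillatory_rpow_le [SFinite ν] (hm : Measurable (Function.uncurry e))
    (he : ∀ z x, ‖e z x‖ ≤ 1)
    (hL : ∀ G : X → ℂ, Integrable G μ →
      ∫⁻ z, ‖∫ x, e z x * G x ∂μ‖ₑ ^ 2 ∂ν ≤ K * ∫⁻ x, ‖G x‖ₑ ^ 2 ∂μ) (hKt : K ≠ ⊤)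
    {q : ℝ} (hq : 2 < q) {G : X → ℂ} (hGm : Measurable G) (hG : Integrable G μ) :
    ∫⁻ z, ‖∫ x, e z x * G x ∂μ‖ₑ ^ q ∂ν
      ≤ ENNReal.ofReal (q * (4 * (2 ^ (q - 2) / (q - 2)))) * K *
        (∫⁻ x, ‖G x‖ₑ ^ (q / (q - 1)) ∂μ) ^ (q - 1) := by
  set q' := q / (q - 1) with hq'
  have hq1 : 0 < q - 1 := by linarith
  have hq2 : 0 < q - 2 := by linarith
  have hq'1 : 1 < q' := by rw [hq', lt_div_iff₀ hq1]; linarith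
  -- This identity makes the interpolation close: `|G|²` from the `L²` bound times the cutoff to the
  -- power `q - 2` is a multiple of `|G|^q'`.
  have hexp : 2 + (1 - q') * (q - 2) = q' := by rw [hq']; field_simp; ring
  set N := ∫⁻ x, ‖G x‖ₑ ^ q' ∂μ with hN
  rcases eq_or_ne N 0 with h0 | h0
  · have hae : G =ᵐ[μ] 0 := by
      rw [hN, lintegral_eq_zero_iff (by fun_prop)] at h0
      filter_upwards [h0] with x hx
      simpa [ENNReal.rpow_eq_zero_iff, (by linarith : (0 : ℝ) < q'), (by linarith : ¬ q' < 0)]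
        using hx
    have hz : ∀ z, ∫ x, e z x * G x ∂μ = 0 := fun z => by
      rw [integral_eq_zero_of_ae]
      filter_upwards [hae] with x hx
      simp [hx]
    simp [hz, (by linarith : (0 : ℝ) < q)]
  rcases eq_or_ne K 0 with hK0 | hK0
  · have h1 := hL G hG
    rw [hK0, zero_mul, nonpos_iff_eq_zero] at h1
    have hSm : AEStronglyMeasurable (fun z => ∫ x, e z x * G x ∂μ) ν :=
      (hm.aestronglyMeasurable.mul hG.1.comp_snd :
        AEStronglyMeasurable (fun p : Z × X => e p.1 p.2 * G p.2)
          (ν.prod μ)).integral_prod_right'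
    rw [lintegral_eq_zero_iff' (hSm.enorm.pow_const 2)] at h1
    refine le_of_eq_of_le ?_ zero_le
    rw [lintegral_eq_zero_iff' (hSm.enorm.pow_const q)]
    filter_upwards [h1] with z hz
    have : ∫ x, e z x * G x ∂μ = 0 := by simpa using hz
    simp [this, (by linarith : (0 : ℝ) < q)]
  rcases eq_or_ne N ⊤ with hT | hT
  · rw [hT, ENNReal.top_rpow_of_pos hq1, ENNReal.mul_top]
    · exact le_top
    · refine mul_ne_zero ?_ hK0
      simp only [ne_eq, ENNReal.ofReal_eq_zero, not_le]
      positivity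
  set n := N.toReal with hn
  have hn0 : 0 < n := ENNReal.toReal_pos h0 hT
  have hNn : N = ENNReal.ofReal n := (ENNReal.ofReal_toReal hT).symm
  -- As `1 - q' < 0`, the condition `t < b x` keeps the small nonzero values of `G` for the `L²`
  -- bound. Where it fails, `‖G‖ ≤ (t / (2n)) ‖G‖^q'`, whose integral is at most `t/2`; this fixes
  -- the factor `2n`.
  set b : X → ℝ := fun x => 2 * n * ‖G x‖ ^ (1 - q') with hb
  have hb0 : ∀ x, 0 ≤ b x := fun x => by positivity
  have hbm : Measurable b := (hGm.norm.pow_const _).const_mul _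
  have hSm : AEStronglyMeasurable (fun z => ∫ x, e z x * G x ∂μ) ν :=
    (hm.aestronglyMeasurable.mul hG.1.comp_snd :
      AEStronglyMeasurable (fun p : Z × X => e p.1 p.2 * G p.2)
        (ν.prod μ)).integral_prod_right'
  have hA : ∀ t, MeasurableSet {x | t < b x} := fun t => measurableSet_lt measurable_const hbm
  have hlevel : ∀ t, 0 < t → ν {z | t < ‖∫ x, e z x * G x ∂μ‖}
      ≤ ENNReal.ofReal (4 * t ^ (-2 : ℝ)) * (K * ∫⁻ x in {x | t < b x}, ‖G x‖ₑ ^ 2 ∂μ) := by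
    intro t ht
    refine measure_lt_norm_oscillatory_le hm he hL hG (hA t) ht ?_
    calc ∫⁻ x in {x | t < b x}ᶜ, ‖G x‖ₑ ∂μ
        ≤ ∫⁻ x in {x | t < b x}ᶜ, ENNReal.ofReal (t / (2 * n)) * ‖G x‖ₑ ^ q' ∂μ := by
          refine setLIntegral_mono' (hA t).compl fun x hx => ?_
          simp only [Set.mem_compl_iff, Set.mem_ofPred_eq, not_lt] at hx
          rw [← ofReal_norm, ENNReal.ofReal_rpow_of_nonneg (norm_nonneg _) (by linarith),
            ← ENNReal.ofReal_mul (by positivity)]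
          refine ENNReal.ofReal_le_ofReal ?_
          rcases eq_or_lt_of_le (norm_nonneg (G x)) with h | h
          · rw [← h]; positivity
          · have hx' : ‖G x‖ ^ (1 - q') ≤ t / (2 * n) := by
              rw [le_div_iff₀ (by positivity), mul_comm]; exact hx
            calc ‖G x‖ = ‖G x‖ ^ (1 - q') * ‖G x‖ ^ q' := by
                  rw [← Real.rpow_add h, sub_add_cancel, Real.rpow_one]
              _ ≤ _ := by gcongr
      _ ≤ ∫⁻ x, ENNReal.ofReal (t / (2 * n)) * ‖G x‖ₑ ^ q' ∂μ := setLIntegral_le_lintegral _ _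
      _ = ENNReal.ofReal (t / 2) := by
          rw [lintegral_const_mul' _ _ ENNReal.ofReal_ne_top, ← hN, hNn,
            ← ENNReal.ofReal_mul (by positivity)]
          congr 1
          field_simp
  have hcake := lintegral_rpow_eq_lintegral_meas_lt_mul (μ := ν)
    (f := fun z => ‖∫ x, e z x * G x ∂μ‖) (Filter.Eventually.of_forall fun _ => norm_nonneg _)
    hSm.norm.aemeasurable (by linarith : 0 < q)
  have hL1 : ∫⁻ z, ‖∫ x, e z x * G x ∂μ‖ₑ ^ q ∂ν
      = ∫⁻ z, ENNReal.ofReal (‖∫ x, e z x * G x ∂μ‖ ^ q) ∂ν := by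
    refine lintegral_congr fun z => ?_
    rw [← ENNReal.ofReal_rpow_of_nonneg (norm_nonneg _) (by linarith), ofReal_norm]
  have hinner : ∀ x, ∫⁻ t in Set.Ioi 0,
      ENNReal.ofReal (t ^ (q - 3)) * (Set.Ioo 0 (b x)).indicator 1 t
      = ENNReal.ofReal (b x ^ (q - 2) / (q - 2)) := by
    intro x
    rw [← lintegral_indicator measurableSet_Ioi]
    have := lintegral_Ioo_rpow (s := q - 3) (by linarith) (hb0 x)
    rw [(by ring : q - 3 + 1 = q - 2), ← lintegral_indicator measurableSet_Ioo] at this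
    rw [← this]
    refine lintegral_congr fun t => ?_
    by_cases h1 : t ∈ Set.Ioo 0 (b x)
    · simp [h1, Set.mem_Ioi.2 h1.1]
    · simp [h1]
  rw [hL1, hcake]
  calc ENNReal.ofReal q * ∫⁻ t in Set.Ioi 0, ν {z | t < ‖∫ x, e z x * G x ∂μ‖} *
          ENNReal.ofReal (t ^ (q - 1))
      ≤ ENNReal.ofReal q * ∫⁻ t in Set.Ioi 0, ENNReal.ofReal 4 * K * ∫⁻ x,
          ‖G x‖ₑ ^ 2 * (ENNReal.ofReal (t ^ (q - 3)) * (Set.Ioo 0 (b x)).indicator 1 t) ∂μ := by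
        gcongr ENNReal.ofReal q * ?_
        refine setLIntegral_mono' measurableSet_Ioi fun t ht => ?_
        have ht : 0 < t := ht
        calc _ ≤ ENNReal.ofReal (4 * t ^ (-2 : ℝ)) * (K * ∫⁻ x in {x | t < b x}, ‖G x‖ₑ ^ 2 ∂μ) *
              ENNReal.ofReal (t ^ (q - 1)) := by
              gcongr
              exact hlevel t ht
          _ = ENNReal.ofReal 4 * K * (ENNReal.ofReal (t ^ (q - 3)) *
              ∫⁻ x in {x | t < b x}, ‖G x‖ₑ ^ 2 ∂μ) := by
              have : t ^ (q - 3) = t ^ (-2 : ℝ) * t ^ (q - 1) := by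
                rw [← Real.rpow_add ht]; congr 1; ring
              rw [this, ENNReal.ofReal_mul (by norm_num), ENNReal.ofReal_mul (by positivity)]
              ring
          _ = _ := by
              rw [← lintegral_indicator (hA t), ← lintegral_const_mul' _ _ ENNReal.ofReal_ne_top]
              congr 2
              funext x
              by_cases hx : t < b x
              · simp [hx, ht, mul_comm]
              · simp [hx]
    _ = ENNReal.ofReal q * (ENNReal.ofReal 4 * K * ∫⁻ x, (∫⁻ t in Set.Ioi 0,
          ‖G x‖ₑ ^ 2 * (ENNReal.ofReal (t ^ (q - 3)) * (Set.Ioo 0 (b x)).indicator 1 t)) ∂μ) := by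
        rw [lintegral_const_mul' _ _ (ENNReal.mul_ne_top ENNReal.ofReal_ne_top hKt),
          lintegral_lintegral_swap]
        refine Measurable.aemeasurable ?_
        refine Measurable.mul (by fun_prop) (Measurable.mul (by fun_prop) ?_)
        have : (Function.uncurry fun (t : ℝ) (x : X) => (Set.Ioo 0 (b x)).indicator
            (1 : ℝ → ℝ≥0∞) t) = Set.indicator {p : ℝ × X | 0 < p.1 ∧ p.1 < b p.2} 1 := by
          funext p
          simp [Function.uncurry, Set.indicator_apply]
        change Measurable (Function.uncurry fun (t : ℝ) (x : X) => (Set.Ioo 0 (b x)).indicator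
            (1 : ℝ → ℝ≥0∞) t)
        rw [this]
        exact measurable_one.indicator ((measurableSet_lt measurable_const measurable_fst).inter
          (measurableSet_lt measurable_fst (hbm.comp measurable_snd)))
    _ = ENNReal.ofReal q * (ENNReal.ofReal 4 * K * ∫⁻ x,
          ENNReal.ofReal ((2 * n) ^ (q - 2) / (q - 2)) * ‖G x‖ₑ ^ q' ∂μ) := by
        congr 2
        refine lintegral_congr fun x => ?_
        rw [lintegral_const_mul' _ _ (by simp), hinner, ← ofReal_norm,
          ENNReal.ofReal_rpow_of_nonneg (norm_nonneg _) (by linarith),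
          ← ENNReal.ofReal_pow (norm_nonneg _), ← ENNReal.ofReal_mul (by positivity),
          ← ENNReal.ofReal_mul (by positivity)]
        congr 1
        rw [hb]
        rcases eq_or_lt_of_le (norm_nonneg (G x)) with h | h
        · rw [← h, Real.zero_rpow (by linarith)]; simp
        · simp only
          rw [Real.mul_rpow (by positivity) (by positivity), ← Real.rpow_mul h.le]
          have : ‖G x‖ ^ q' = ‖G x‖ ^ 2 * ‖G x‖ ^ ((1 - q') * (q - 2)) := by
            rw [← Real.rpow_natCast, ← Real.rpow_add h]
            congr 1
            push_cast
            exact hexp.symm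
          rw [this]
          ring
    _ = _ := by
        rw [lintegral_const_mul' _ _ ENNReal.ofReal_ne_top, ← hN, hNn,
          ENNReal.ofReal_rpow_of_nonneg hn0.le hq1.le, ENNReal.ofReal_mul (by linarith : 0 ≤ q),
          ENNReal.ofReal_mul (by norm_num : (0 : ℝ) ≤ 4)]
        have : ENNReal.ofReal ((2 * n) ^ (q - 2) / (q - 2)) * ENNReal.ofReal n
            = ENNReal.ofReal (2 ^ (q - 2) / (q - 2)) * ENNReal.ofReal (n ^ (q - 1)) := by
          rw [← ENNReal.ofReal_mul (by positivity), ← ENNReal.ofReal_mul (by positivity)]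
          congr 1
          rw [Real.mul_rpow (by norm_num) hn0.le, (by ring : q - 1 = (q - 2) + 1),
            Real.rpow_add hn0, Real.rpow_one]
          ring
        rw [this]
        ring

end Oscillatory

/-! ### The Hardy–Littlewood–Sobolev inequality on the line. -/

/-- The layer cake formula with a weight. -/
theorem lintegral_ofReal_mul_eq_lintegral_superlevel {X : Type*} [MeasurableSpace X]
    {μ : Measure X} {A : X → ℝ} (hA : Measurable A) (hA0 : ∀ x, 0 ≤ A x) {w : X → ℝ≥0∞}
    (hw : Measurable w) :
    ∫⁻ x, ENNReal.ofReal (A x) * w x ∂μ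
      = ∫⁻ a in Set.Ioi 0, ∫⁻ x in {x | a < A x}, w x ∂μ := by
  have h := lintegral_eq_lintegral_meas_lt (μ.withDensity w) (f := A)
    (Filter.Eventually.of_forall hA0) hA.aemeasurable
  rw [lintegral_withDensity_eq_lintegral_mul _ hw (by fun_prop)] at h
  simp only [Pi.mul_apply, mul_comm (w _)] at h
  rw [h]
  refine lintegral_congr fun a => ?_
  rw [withDensity_apply _ (measurableSet_lt measurable_const hA)]

section Riesz

variable {α : ℝ}

/-- The Riesz potential of a set. -/
theorem setLIntegral_rieszKernel_le (h0 : 0 < α) (h1 : α < 1) (u : ℝ) (Y : Set ℝ) :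
    ∫⁻ v in Y, ENNReal.ofReal (|u - v| ^ (-α))
      ≤ ENNReal.ofReal (2 / (1 - α) + 1) * volume Y ^ (1 - α) := by
  have h1' : 0 < 1 - α := by linarith
  rcases eq_or_ne (volume Y) 0 with hY | hY
  · rw [Measure.restrict_eq_zero.2 hY]; simp
  rcases eq_or_ne (volume Y) ⊤ with hT | hT
  · rw [hT, ENNReal.top_rpow_of_pos h1', ENNReal.mul_top]
    · exact le_top
    · simp only [ne_eq, ENNReal.ofReal_eq_zero, not_le]; positivity
  -- The kernel is cut at distance `R = |Y|`: the near part is integrated explicitly on both sides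
  -- of `u`, giving `2/(1-α)`, and the far part is at most `R^(-α) |Y|`, giving the `1`.
  set R := (volume Y).toReal with hR
  have hR0 : 0 < R := ENNReal.toReal_pos hY hT
  have hRY : volume Y = ENNReal.ofReal R := (ENNReal.ofReal_toReal hT).symm
  set f : ℝ → ℝ≥0∞ := (Set.Ioo 0 R).indicator fun w => ENNReal.ofReal (w ^ (-α)) with hf
  have hfm : Measurable f := Measurable.indicator (by fun_prop) measurableSet_Ioo
  have hfi : ∫⁻ w, f w = ENNReal.ofReal (R ^ (1 - α) / (1 - α)) := by
    rw [hf, lintegral_indicator measurableSet_Ioo, lintegral_Ioo_rpow (by linarith) hR0.le,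
      neg_add_eq_sub]
  have hpt : ∀ v, ENNReal.ofReal (|u - v| ^ (-α))
      ≤ f (v - u) + f (u - v) + ENNReal.ofReal (R ^ (-α)) := by
    intro v
    rcases le_or_gt R |u - v| with h | h
    · refine le_add_left (ENNReal.ofReal_le_ofReal ?_)
      exact Real.rpow_le_rpow_of_nonpos hR0 h (by linarith)
    · refine le_add_right ?_
      rcases lt_trichotomy u v with hl | hl | hl
      · have hm : v - u ∈ Set.Ioo 0 R := ⟨by linarith, by rw [abs_lt] at h; linarith⟩
        refine le_add_right ?_
        rw [hf, Set.indicator_of_mem hm, abs_sub_comm, abs_of_pos hm.1]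
      · simp [hl, Real.zero_rpow (neg_ne_zero.2 h0.ne')]
      · have hm : u - v ∈ Set.Ioo 0 R := ⟨by linarith, by rw [abs_lt] at h; linarith⟩
        refine le_add_left ?_
        rw [hf, Set.indicator_of_mem hm, abs_of_pos hm.1]
  calc ∫⁻ v in Y, ENNReal.ofReal (|u - v| ^ (-α))
      ≤ ∫⁻ v in Y, (f (v - u) + f (u - v) + ENNReal.ofReal (R ^ (-α))) := lintegral_mono hpt
    _ = (∫⁻ v in Y, f (v - u)) + (∫⁻ v in Y, f (u - v)) + ENNReal.ofReal (R ^ (-α)) * volume Y := by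
        rw [lintegral_add_left (by fun_prop), lintegral_add_left (by fun_prop), setLIntegral_const]
    _ ≤ (∫⁻ v, f (v - u)) + (∫⁻ v, f (u - v)) + ENNReal.ofReal (R ^ (-α)) * volume Y := by
        gcongr <;> exact Measure.restrict_le_self
    _ = _ := by
        rw [lintegral_sub_right_eq_self f u, lintegral_sub_left_eq_self f u, hfi, hRY,
          ENNReal.ofReal_rpow_of_pos hR0, ← ENNReal.ofReal_mul (by positivity),
          ← ENNReal.ofReal_mul (by positivity), ← ENNReal.ofReal_add (by positivity) (by positivity),
          ← ENNReal.ofReal_add (by positivity) (by positivity), sub_eq_neg_add 1 α,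
          Real.rpow_add hR0, Real.rpow_one]
        congr 1
        ring

theorem setLIntegral_setLIntegral_rieszKernel_le (h0 : 0 < α) (h1 : α < 1) (X Y : Set ℝ) :
    ∫⁻ v in Y, ∫⁻ u in X, ENNReal.ofReal (|u - v| ^ (-α))
      ≤ ENNReal.ofReal (2 / (1 - α) + 1) * (volume X ^ (1 - α) * volume Y) := by
  calc ∫⁻ v in Y, ∫⁻ u in X, ENNReal.ofReal (|u - v| ^ (-α))
      ≤ ∫⁻ v in Y, ENNReal.ofReal (2 / (1 - α) + 1) * volume X ^ (1 - α) := by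
        refine lintegral_mono fun v => ?_
        simp only [abs_sub_comm _ v]
        exact setLIntegral_rieszKernel_le h0 h1 v X
    _ = _ := by rw [setLIntegral_const, mul_assoc]

theorem setLIntegral_setLIntegral_rieszKernel_le' (h0 : 0 < α) (h1 : α < 1) (X Y : Set ℝ) :
    ∫⁻ v in Y, ∫⁻ u in X, ENNReal.ofReal (|u - v| ^ (-α))
      ≤ ENNReal.ofReal (2 / (1 - α) + 1) * (volume X * volume Y ^ (1 - α)) := by
  rw [lintegral_lintegral_swap (by fun_prop)]
  rw [mul_comm (volume X)]
  refine le_of_eq_of_le (lintegral_congr fun u => lintegral_congr fun v => ?_)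
    (setLIntegral_setLIntegral_rieszKernel_le h0 h1 Y X)
  rw [abs_sub_comm]

/-- A Hardy type inequality for distribution functions. -/
theorem setLIntegral_Ioc_rpow_le (h0 : 0 < α) (h1 : α < 1) {w : ℝ → ℝ≥0∞} (hw : Measurable w)
    {a : ℝ} (ha : 0 < a) :
    ∫⁻ b in Set.Ioc 0 a, w b ^ (1 - α)
      ≤ (∫⁻ b in Set.Ioi 0, w b * ENNReal.ofReal (b ^ (2 / (2 - α) - 1))) ^ (1 - α) *
        ENNReal.ofReal ((2 - α) ^ α * a ^ (2 / (2 - α) - 1)) := by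
  have h2 : 0 < 2 - α := by linarith
  set m := 2 / (2 - α) - 1 with hm
  have hm' : m = α / (2 - α) := by rw [hm]; field_simp; ring
  -- Hölder with exponents `1/(1-α)` and `1/α` is applied to `w^(1-α) = (w b^m)^(1-α) (b^(-s))^α`.
  -- The weights cancel when `sα = m(1-α)`, and `s < 1` keeps `b^(-s)` integrable at zero.
  set s := (1 - α) / (2 - α) with hs
  have hs1 : s < 1 := by rw [hs, div_lt_one h2]; linarith
  have hs0 : 0 ≤ s := div_nonneg (by linarith) h2.le
  have hsm : s * α = m * (1 - α) := by rw [hs, hm']; ring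
  have hs' : -s + 1 = (2 - α)⁻¹ := by rw [hs]; field_simp; ring
  calc ∫⁻ b in Set.Ioc 0 a, w b ^ (1 - α)
      = ∫⁻ b in Set.Ioo 0 a, (w b * ENNReal.ofReal (b ^ m)) ^ (1 - α) *
          ENNReal.ofReal (b ^ (-s)) ^ α := by
        rw [setLIntegral_congr Ioo_ae_eq_Ioc.symm]
        refine setLIntegral_congr_fun measurableSet_Ioo fun b hb => ?_
        have hb : 0 < b := hb.1
        rw [ENNReal.mul_rpow_of_nonneg _ _ (by linarith),
          ENNReal.ofReal_rpow_of_pos (by positivity), ENNReal.ofReal_rpow_of_pos (by positivity),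
          mul_assoc, ← ENNReal.ofReal_mul (by positivity), ← Real.rpow_mul hb.le,
          ← Real.rpow_mul hb.le, ← Real.rpow_add hb, neg_mul, hsm, add_neg_cancel, Real.rpow_zero,
          ENNReal.ofReal_one, mul_one]
    _ ≤ (∫⁻ b in Set.Ioo 0 a, w b * ENNReal.ofReal (b ^ m)) ^ (1 - α) *
          (∫⁻ b in Set.Ioo 0 a, ENNReal.ofReal (b ^ (-s))) ^ α :=
        ENNReal.lintegral_mul_norm_pow_le (by fun_prop) (by fun_prop) (by linarith) h0.le (by ring)
    _ ≤ _ := by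
        rw [lintegral_Ioo_rpow (by linarith) ha.le, ENNReal.ofReal_rpow_of_nonneg
          (div_nonneg (by positivity) (by linarith)) h0.le]
        refine mul_le_mul' ?_ (le_of_eq ?_)
        · refine ENNReal.rpow_le_rpow ?_ (by linarith)
          exact lintegral_mono_set Set.Ioo_subset_Ioi_self
        · congr 1
          rw [hs', div_inv_eq_mul, Real.mul_rpow (by positivity) h2.le, ← Real.rpow_mul ha.le, hm',
            mul_comm, inv_mul_eq_div]

/-- Layer cake reduces the form to superlevel sets at heights `a`, `b`, of measures `V a`, `W b`.
For `b ≤ a` the bound `V a · W b^(1-α)` is used, otherwise the one with the roles exchanged. The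
Hardy inequality in the smaller height then leaves the layer cake weight in the larger one. -/
theorem lintegral_lintegral_rieszKernel_le_add (h0 : 0 < α) (h1 : α < 1) {A B : ℝ → ℝ}
    (hA : Measurable A) (hB : Measurable B) (hA0 : ∀ x, 0 ≤ A x) (hB0 : ∀ x, 0 ≤ B x) :
    ∫⁻ u, ENNReal.ofReal (A u) * ∫⁻ v, ENNReal.ofReal (B v) * ENNReal.ofReal (|u - v| ^ (-α))
      ≤ ENNReal.ofReal (2 / (1 - α) + 1) * ENNReal.ofReal ((2 - α) ^ α) *
        ((∫⁻ u, ENNReal.ofReal (A u ^ (2 / (2 - α)))) *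
            (∫⁻ v, ENNReal.ofReal (B v ^ (2 / (2 - α)))) ^ (1 - α) +
          (∫⁻ v, ENNReal.ofReal (B v ^ (2 / (2 - α)))) *
            (∫⁻ u, ENNReal.ofReal (A u ^ (2 / (2 - α)))) ^ (1 - α)) := by
  have h2 : 0 < 2 - α := by linarith
  set p := 2 / (2 - α) with hp
  have hp1 : 1 ≤ p := by rw [hp, le_div_iff₀ h2]; linarith
  set C := ENNReal.ofReal (2 / (1 - α) + 1) with hC
  set V : ℝ → ℝ≥0∞ := fun a => volume {u | a < A u} with hV
  set W : ℝ → ℝ≥0∞ := fun b => volume {v | b < B v} with hW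
  have hVm : Measurable V := (Antitone.measurable fun a b hab =>
    measure_mono fun u (hu : b < A u) => lt_of_le_of_lt hab hu)
  have hWm : Measurable W := (Antitone.measurable fun a b hab =>
    measure_mono fun u (hu : b < B u) => lt_of_le_of_lt hab hu)
  have hcake : ∀ {D : ℝ → ℝ}, Measurable D → (∀ x, 0 ≤ D x) →
      ∫⁻ a in Set.Ioi 0, volume {u | a < D u} * ENNReal.ofReal (a ^ (p - 1))
        ≤ ∫⁻ u, ENNReal.ofReal (D u ^ p) := by
    intro D hD hD0
    rw [lintegral_rpow_eq_lintegral_meas_lt_mul volume (Filter.Eventually.of_forall hD0)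
      hD.aemeasurable (by linarith : 0 < p)]
    refine le_mul_of_one_le_left zero_le ?_
    rwa [ENNReal.one_le_ofReal]
  have hrep : ∫⁻ u, ENNReal.ofReal (A u) * ∫⁻ v, ENNReal.ofReal (B v) *
        ENNReal.ofReal (|u - v| ^ (-α))
      = ∫⁻ a in Set.Ioi 0, ∫⁻ b in Set.Ioi 0, ∫⁻ v in {v | b < B v}, ∫⁻ u in {u | a < A u},
          ENNReal.ofReal (|u - v| ^ (-α)) := by
    rw [lintegral_ofReal_mul_eq_lintegral_superlevel hA hA0 (by fun_prop)]
    refine lintegral_congr fun a => ?_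
    rw [lintegral_lintegral_swap (by fun_prop)]
    rw [← lintegral_ofReal_mul_eq_lintegral_superlevel hB hB0 (by fun_prop)]
    refine lintegral_congr fun v => ?_
    rw [lintegral_const_mul' _ _ ENNReal.ofReal_ne_top]
  have hpt : ∀ a b, ∫⁻ v in {v | b < B v}, ∫⁻ u in {u | a < A u}, ENNReal.ofReal (|u - v| ^ (-α))
      ≤ C * ((Set.Iic a).indicator (fun b => V a * W b ^ (1 - α)) b
        + (Set.Iic b).indicator (fun a => V a ^ (1 - α) * W b) a) := by
    intro a b
    rcases le_total b a with hab | hab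
    · refine (setLIntegral_setLIntegral_rieszKernel_le' h0 h1 _ _).trans ?_
      gcongr
      rw [Set.indicator_of_mem (Set.mem_Iic.2 hab)]
      exact le_self_add
    · refine (setLIntegral_setLIntegral_rieszKernel_le h0 h1 _ _).trans ?_
      gcongr
      rw [Set.indicator_of_mem (Set.mem_Iic.2 hab)]
      exact le_add_self
  have hm1 : Measurable (Function.uncurry fun a b : ℝ =>
      (Set.Iic a).indicator (fun b => V a * W b ^ (1 - α)) b) := by
    have : (Function.uncurry fun a b : ℝ => (Set.Iic a).indicator (fun b => V a * W b ^ (1 - α)) b)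
        = Set.indicator {p : ℝ × ℝ | p.2 ≤ p.1} fun p => V p.1 * W p.2 ^ (1 - α) := by
      funext p
      simp [Function.uncurry, Set.indicator_apply]
    rw [this]
    exact Measurable.indicator (by fun_prop) (measurableSet_le measurable_snd measurable_fst)
  have hm2 : Measurable (Function.uncurry fun a b : ℝ =>
      (Set.Iic b).indicator (fun a => V a ^ (1 - α) * W b) a) := by
    have : (Function.uncurry fun a b : ℝ => (Set.Iic b).indicator (fun a => V a ^ (1 - α) * W b) a)
        = Set.indicator {p : ℝ × ℝ | p.1 ≤ p.2} fun p => V p.1 ^ (1 - α) * W p.2 := by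
      funext p
      simp [Function.uncurry, Set.indicator_apply]
    rw [this]
    exact Measurable.indicator (by fun_prop) (measurableSet_le measurable_fst measurable_snd)
  have hhalf : ∀ {V W : ℝ → ℝ≥0∞}, Measurable V → Measurable W →
      ∫⁻ a in Set.Ioi 0, ∫⁻ b in Set.Ioi 0, (Set.Iic a).indicator (fun b => V a * W b ^ (1 - α)) b
        ≤ ENNReal.ofReal ((2 - α) ^ α) *
          ((∫⁻ a in Set.Ioi 0, V a * ENNReal.ofReal (a ^ (p - 1))) *
            (∫⁻ b in Set.Ioi 0, W b * ENNReal.ofReal (b ^ (p - 1))) ^ (1 - α)) := by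
    intro V W hV hW
    set D := (∫⁻ b in Set.Ioi 0, W b * ENNReal.ofReal (b ^ (p - 1))) ^ (1 - α)
    calc ∫⁻ a in Set.Ioi 0, ∫⁻ b in Set.Ioi 0,
          (Set.Iic a).indicator (fun b => V a * W b ^ (1 - α)) b
        ≤ ∫⁻ a in Set.Ioi 0, (ENNReal.ofReal ((2 - α) ^ α) * D) *
            (V a * ENNReal.ofReal (a ^ (p - 1))) := by
          refine setLIntegral_mono' measurableSet_Ioi fun a ha => ?_
          rw [setLIntegral_indicator measurableSet_Iic, Set.Iic_inter_Ioi,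
            lintegral_const_mul _ (by fun_prop)]
          refine (mul_le_mul_right (setLIntegral_Ioc_rpow_le h0 h1 hW ha) _).trans_eq ?_
          rw [ENNReal.ofReal_mul (by positivity)]
          ring
      _ = _ := by
          rw [lintegral_const_mul _ (by fun_prop)]
          ring
  rw [hrep]
  calc _ ≤ ∫⁻ a in Set.Ioi 0, ∫⁻ b in Set.Ioi 0,
        C * ((Set.Iic a).indicator (fun b => V a * W b ^ (1 - α)) b
        + (Set.Iic b).indicator (fun a => V a ^ (1 - α) * W b) a) :=
        lintegral_mono fun a => lintegral_mono fun b => hpt a b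
    _ = C * ((∫⁻ a in Set.Ioi 0, ∫⁻ b in Set.Ioi 0,
          (Set.Iic a).indicator (fun b => V a * W b ^ (1 - α)) b) +
          ∫⁻ b in Set.Ioi 0, ∫⁻ a in Set.Ioi 0,
          (Set.Iic b).indicator (fun a => W b * V a ^ (1 - α)) a) := by
        have e1 : ∀ a, Measurable fun b => (Set.Iic a).indicator (fun b => V a * W b ^ (1 - α)) b :=
          fun a => hm1.comp measurable_prodMk_left
        have e2 : ∀ a, Measurable fun b => (Set.Iic b).indicator (fun a => V a ^ (1 - α) * W b) a :=
          fun a => hm2.comp measurable_prodMk_left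
        have e3 : ∀ a, ∫⁻ b in Set.Ioi 0,
            C * ((Set.Iic a).indicator (fun b => V a * W b ^ (1 - α)) b
              + (Set.Iic b).indicator (fun a => V a ^ (1 - α) * W b) a)
            = C * ((∫⁻ b in Set.Ioi 0, (Set.Iic a).indicator (fun b => V a * W b ^ (1 - α)) b)
              + ∫⁻ b in Set.Ioi 0, (Set.Iic b).indicator (fun a => V a ^ (1 - α) * W b) a) := by
          intro a
          rw [lintegral_const_mul' _ _ ENNReal.ofReal_ne_top, lintegral_add_left (e1 a)]
        have e4 : Measurable fun a => ∫⁻ b in Set.Ioi 0,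
            (Set.Iic a).indicator (fun b => V a * W b ^ (1 - α)) b := hm1.lintegral_prod_right'
        simp only [e3]
        rw [lintegral_const_mul' _ _ ENNReal.ofReal_ne_top, lintegral_add_left e4]
        congr 2
        rw [lintegral_lintegral_swap hm2.aemeasurable]
        simp only [mul_comm]
    _ ≤ C * (ENNReal.ofReal ((2 - α) ^ α) *
          ((∫⁻ a in Set.Ioi 0, V a * ENNReal.ofReal (a ^ (p - 1))) *
            (∫⁻ b in Set.Ioi 0, W b * ENNReal.ofReal (b ^ (p - 1))) ^ (1 - α)) +
          ENNReal.ofReal ((2 - α) ^ α) *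
          ((∫⁻ a in Set.Ioi 0, W a * ENNReal.ofReal (a ^ (p - 1))) *
            (∫⁻ b in Set.Ioi 0, V b * ENNReal.ofReal (b ^ (p - 1))) ^ (1 - α))) :=
        mul_le_mul_right (add_le_add (hhalf hVm hWm) (hhalf hWm hVm)) _
    _ ≤ _ := by
        rw [← mul_add, ← mul_assoc]
        have hA' := hcake hA hA0
        have hB' := hcake hB hB0
        have hα : 0 ≤ 1 - α := by linarith
        gcongr

/-- The constant in the Hardy–Littlewood–Sobolev inequality on the line. -/
def rieszConst (α : ℝ) : ℝ≥0∞ :=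
  ENNReal.ofReal (2 / (1 - α) + 1) * ENNReal.ofReal ((2 - α) ^ α) * 2

theorem rieszConst_ne_top : rieszConst α ≠ ⊤ :=
  ENNReal.mul_ne_top (ENNReal.mul_ne_top ENNReal.ofReal_ne_top ENNReal.ofReal_ne_top) (by simp)

/-- The Hardy–Littlewood–Sobolev inequality on the line (with equal exponents). -/
theorem lintegral_lintegral_rieszKernel_le (h0 : 0 < α) (h1 : α < 1) {A B : ℝ → ℝ}
    (hA : Measurable A) (hB : Measurable B) (hA0 : ∀ x, 0 ≤ A x) (hB0 : ∀ x, 0 ≤ B x)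
    (hAt : ∫⁻ u, ENNReal.ofReal (A u ^ (2 / (2 - α))) ≠ ⊤)
    (hBt : ∫⁻ u, ENNReal.ofReal (B u ^ (2 / (2 - α))) ≠ ⊤) :
    ∫⁻ u, ENNReal.ofReal (A u) * ∫⁻ v, ENNReal.ofReal (B v) * ENNReal.ofReal (|u - v| ^ (-α))
      ≤ rieszConst α * ((∫⁻ u, ENNReal.ofReal (A u ^ (2 / (2 - α)))) ^ (1 - α / 2) *
        (∫⁻ v, ENNReal.ofReal (B v ^ (2 / (2 - α)))) ^ (1 - α / 2)) := by
  have h2 : 0 < 2 - α := by linarith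
  set p := 2 / (2 - α) with hp
  have hp0 : 0 < p := by positivity
  have hpi : 1 - α / 2 = p⁻¹ := by rw [hp]; field_simp
  have hzero : ∀ {D : ℝ → ℝ}, Measurable D → (∀ x, 0 ≤ D x) →
      ∫⁻ u, ENNReal.ofReal (D u ^ p) = 0 → ∀ᵐ x, D x = 0 := by
    intro D hD hD0 h
    rw [lintegral_eq_zero_iff (by fun_prop)] at h
    filter_upwards [h] with x hx
    have h3 : D x ^ p ≤ 0 := by simpa using hx
    exact (Real.rpow_eq_zero (hD0 x) hp0.ne').1 (le_antisymm h3 (Real.rpow_nonneg (hD0 x) _))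
  rcases eq_or_ne (∫⁻ u, ENNReal.ofReal (A u ^ p)) 0 with hz | hAz
  · rw [lintegral_eq_zero_of_ae_eq_zero]
    · exact zero_le
    · filter_upwards [hzero hA hA0 hz] with x hx
      simp [hx]
  rcases eq_or_ne (∫⁻ u, ENNReal.ofReal (B u ^ p)) 0 with hz | hBz
  · have : ∀ u, ∫⁻ v, ENNReal.ofReal (B v) * ENNReal.ofReal (|u - v| ^ (-α)) = 0 := by
      intro u
      refine lintegral_eq_zero_of_ae_eq_zero ?_
      filter_upwards [hzero hB hB0 hz] with x hx
      simp [hx]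
    simp [this]
  -- The additive bound is not homogeneous. After dividing `A` and `B` by their norms `x` and `y`,
  -- its two summands are both 1, which is the final 2 in `rieszConst`.
  obtain ⟨x, hx0, hx⟩ : ∃ x : ℝ, 0 < x ∧ ∫⁻ u, ENNReal.ofReal (A u ^ p) = ENNReal.ofReal (x ^ p) := by
    have h3 := ENNReal.toReal_pos hAz hAt
    refine ⟨(∫⁻ u, ENNReal.ofReal (A u ^ p)).toReal ^ p⁻¹, by positivity, ?_⟩
    rw [Real.rpow_inv_rpow h3.le hp0.ne', ENNReal.ofReal_toReal hAt]
  obtain ⟨y, hy0, hy⟩ : ∃ x : ℝ, 0 < x ∧ ∫⁻ u, ENNReal.ofReal (B u ^ p) = ENNReal.ofReal (x ^ p) := by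
    have h3 := ENNReal.toReal_pos hBz hBt
    refine ⟨(∫⁻ u, ENNReal.ofReal (B u ^ p)).toReal ^ p⁻¹, by positivity, ?_⟩
    rw [Real.rpow_inv_rpow h3.le hp0.ne', ENNReal.ofReal_toReal hBt]
  have hnorm : ∀ {D : ℝ → ℝ} {x : ℝ}, (∀ x, 0 ≤ D x) → 0 < x →
      ∫⁻ u, ENNReal.ofReal (D u ^ p) = ENNReal.ofReal (x ^ p) →
      ∫⁻ u, ENNReal.ofReal ((x⁻¹ * D u) ^ p) = 1 := by
    intro D x hD hx h
    have : ∀ u, ENNReal.ofReal ((x⁻¹ * D u) ^ p)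
        = ENNReal.ofReal ((x ^ p)⁻¹) * ENNReal.ofReal (D u ^ p) := by
      intro u
      rw [Real.mul_rpow (by positivity) (hD u), Real.inv_rpow hx.le,
        ENNReal.ofReal_mul (by positivity)]
    simp only [this]
    rw [lintegral_const_mul' _ _ ENNReal.ofReal_ne_top, h, ← ENNReal.ofReal_mul (by positivity),
      inv_mul_cancel₀ (by positivity), ENNReal.ofReal_one]
  have key := lintegral_lintegral_rieszKernel_le_add h0 h1 (hA.const_mul x⁻¹) (hB.const_mul y⁻¹)
    (fun u => mul_nonneg (by positivity) (hA0 u)) (fun u => mul_nonneg (by positivity) (hB0 u))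
  rw [← hp, hnorm hA0 hx0 hx, hnorm hB0 hy0 hy, ENNReal.one_rpow, one_mul, one_add_one_eq_two] at key
  have hscale : ∫⁻ u, ENNReal.ofReal (A u) * ∫⁻ v, ENNReal.ofReal (B v) *
        ENNReal.ofReal (|u - v| ^ (-α))
      = ENNReal.ofReal (x * y) * ∫⁻ u, ENNReal.ofReal (x⁻¹ * A u) *
        ∫⁻ v, ENNReal.ofReal (y⁻¹ * B v) * ENNReal.ofReal (|u - v| ^ (-α)) := by
    rw [← lintegral_const_mul' _ _ ENNReal.ofReal_ne_top]
    refine lintegral_congr fun u => ?_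
    have hin : ENNReal.ofReal y * ∫⁻ v, ENNReal.ofReal (y⁻¹ * B v) *
        ENNReal.ofReal (|u - v| ^ (-α)) = ∫⁻ v, ENNReal.ofReal (B v) *
        ENNReal.ofReal (|u - v| ^ (-α)) := by
      rw [← lintegral_const_mul' _ _ ENNReal.ofReal_ne_top]
      refine lintegral_congr fun v => ?_
      rw [← mul_assoc, ← ENNReal.ofReal_mul hy0.le, mul_inv_cancel_left₀ hy0.ne']
    rw [ENNReal.ofReal_mul hx0.le,
      (by intros; ring : ∀ a b c d : ℝ≥0∞, a * b * (c * d) = (a * c) * (b * d)),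
      ← ENNReal.ofReal_mul hx0.le, mul_inv_cancel_left₀ hx0.ne', hin]
  rw [hscale, hx, hy, ENNReal.ofReal_rpow_of_pos (by positivity),
    ENNReal.ofReal_rpow_of_pos (by positivity), ← ENNReal.ofReal_mul (by positivity), hpi,
    Real.rpow_rpow_inv hx0.le hp0.ne', Real.rpow_rpow_inv hy0.le hp0.ne', mul_comm]
  exact mul_le_mul_left key _

end Riesz

/-! ### The bilinear extension estimate for two caps. -/

/-- The extension operator in the coordinate `u = arsinh y`. -/
def waveIntegral (g : ℝ → ℂ) (z : ℝ × ℝ) : ℂ := ∫ u, wave z u * g u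

/-- The cap `𝒞_k` in the coordinate `u = arsinh y`. -/
def unitCap (k : ℤ) : Set ℝ := Set.Ico ((k : ℝ) - 1 / 2) ((k : ℝ) + 1 / 2)

theorem measurableSet_unitCap (k : ℤ) : MeasurableSet (unitCap k) := measurableSet_Ico

theorem continuous_waveIntegral {g : ℝ → ℂ} (hg : Integrable g) :
    Continuous (waveIntegral g) := by
  refine continuous_of_dominated (bound := fun u => ‖g u‖) ?_ ?_ hg.norm ?_
  · intro z
    exact (continuous_wave.comp
      (by fun_prop : Continuous fun u : ℝ => (z, u))).aestronglyMeasurable.mul hg.1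
  · intro z
    filter_upwards with u
    simp [norm_wave]
  · filter_upwards with u
    exact (continuous_wave.comp (by fun_prop : Continuous fun z : ℝ × ℝ => (z, u))).mul
      continuous_const

section Bilinear

/-- The density of `g(u) h(v) du dv` with respect to `pairMeasure`. -/
def pairDensity (g h : ℝ → ℂ) (p : ℝ × ℝ) : ℂ :=
  (|Real.sinh (p.1 - p.2)|⁻¹ : ℝ) * (g p.1 * h p.2)

theorem ae_sinh_sub_ne_zero : ∀ᵐ p : ℝ × ℝ, Real.sinh (p.1 - p.2) ≠ 0 := by
  rw [Measure.volume_eq_prod, Measure.ae_prod_iff_ae_ae]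
  · refine Filter.Eventually.of_forall fun u => ?_
    have : ∀ᵐ v : ℝ, v ≠ u := by simp [ae_iff]
    filter_upwards [this] with v hv
    simpa [sub_eq_zero] using hv.symm
  · exact (measurableSet_eq_fun (by fun_prop) measurable_const).compl

variable {g h : ℝ → ℂ}

theorem abs_sinh_smul_pairDensity (c : ℂ) :
    (fun p : ℝ × ℝ => (ENNReal.ofReal |Real.sinh (p.1 - p.2)|).toReal • (c * pairDensity g h p))
      =ᵐ[volume] fun p => c * (g p.1 * h p.2) := by
  filter_upwards [ae_sinh_sub_ne_zero] with p hp
  rw [ENNReal.toReal_ofReal (abs_nonneg _), pairDensity, Complex.real_smul]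
  have : ((|Real.sinh (p.1 - p.2)| : ℝ) : ℂ) ≠ 0 := by
    exact_mod_cast abs_ne_zero.2 hp
  push_cast
  field_simp

theorem integrable_pairDensity (hg : Integrable g) (hh : Integrable h) :
    Integrable (pairDensity g h) pairMeasure := by
  rw [pairMeasure, integrable_withDensity_iff_integrable_smul' measurable_pairDensity
    (Filter.Eventually.of_forall fun _ => ENNReal.ofReal_lt_top)]
  have h1 := abs_sinh_smul_pairDensity (g := g) (h := h) 1
  simp only [one_mul] at h1
  rw [integrable_congr h1]
  exact hg.mul_prod hh

/-- The Jacobian in the measure cancels the one in the density away from the diagonal, a null set,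
and Fubini splits the remaining product. -/
theorem integral_pairDensity (z : ℝ × ℝ) :
    ∫ p, wavePair z p * pairDensity g h p ∂pairMeasure = waveIntegral g z * waveIntegral h z := by
  rw [pairMeasure, integral_withDensity_eq_integral_toReal_smul measurable_pairDensity
    (Filter.Eventually.of_forall fun _ => ENNReal.ofReal_lt_top), waveIntegral, waveIntegral,
    ← integral_prod_mul, ← Measure.volume_eq_prod]
  refine integral_congr_ae ?_
  filter_upwards [ae_sinh_sub_ne_zero] with p hp
  rw [ENNReal.toReal_ofReal (abs_nonneg _), pairDensity, Complex.real_smul, wavePair]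
  have : ((|Real.sinh (p.1 - p.2)| : ℝ) : ℂ) ≠ 0 := by
    exact_mod_cast abs_ne_zero.2 hp
  push_cast
  field_simp

theorem lintegral_enorm_pairDensity_rpow_le (hg : Measurable g) (hh : Measurable h) {s : ℝ}
    (hs : 0 < s) :
    ∫⁻ p, ‖pairDensity g h p‖ₑ ^ s ∂pairMeasure
      ≤ ∫⁻ u, ENNReal.ofReal (‖g u‖ ^ s) * ∫⁻ v, ENNReal.ofReal (‖h v‖ ^ s) *
        ENNReal.ofReal (|Real.sinh (u - v)| ^ (1 - s)) := by
  have hm : Measurable (pairDensity g h) := by unfold pairDensity; fun_prop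
  rw [pairMeasure, lintegral_withDensity_eq_lintegral_mul _ measurable_pairDensity (by fun_prop),
    Measure.volume_eq_prod, lintegral_prod _ (by fun_prop)]
  refine lintegral_mono fun u => ?_
  rw [← lintegral_const_mul' _ _ ENNReal.ofReal_ne_top]
  refine lintegral_mono fun v => ?_
  simp only [Pi.mul_apply]
  rw [← ofReal_norm, ENNReal.ofReal_rpow_of_nonneg (norm_nonneg _) hs.le,
    ← ENNReal.ofReal_mul (by positivity), ← ENNReal.ofReal_mul (by positivity),
    ← ENNReal.ofReal_mul (by positivity)]
  refine ENNReal.ofReal_le_ofReal ?_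
  rcases eq_or_lt_of_le (abs_nonneg (Real.sinh (u - v))) with h0 | h0
  · rw [← h0, zero_mul]; positivity
  · refine le_of_eq ?_
    rw [pairDensity, norm_mul, norm_mul, Complex.norm_real, Real.norm_of_nonneg (by positivity),
      Real.mul_rpow (by positivity) (by positivity), Real.mul_rpow (by positivity) (by positivity),
      Real.inv_rpow h0.le, Real.rpow_sub h0, Real.rpow_one]
    field_simp

/-- The `L²` bound for the extension of a product, with its constant. -/
def pairConst : ℝ≥0∞ := 2 * ENNReal.ofReal ((2 * Real.pi) ^ 2)

theorem pairConst_ne_top : pairConst ≠ ⊤ := ENNReal.mul_ne_top (by simp) ENNReal.ofReal_ne_top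

/-- Hausdorff–Young for the operator with kernel `wavePair`, applied to `pairDensity g h`. The
inequality `q > 2` is strict because the interpolation constant blows up at `q = 2`. -/
theorem lintegral_enorm_waveIntegral_mul_rpow_le (hgm : Measurable g) (hhm : Measurable h)
    (hg : Integrable g) (hh : Integrable h) {q : ℝ} (hq : 2 < q) :
    ∫⁻ z, ‖waveIntegral g z * waveIntegral h z‖ₑ ^ q
      ≤ ENNReal.ofReal (q * (4 * (2 ^ (q - 2) / (q - 2)))) * pairConst *
        (∫⁻ u, ENNReal.ofReal (‖g u‖ ^ (q / (q - 1))) *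
          ∫⁻ v, ENNReal.ofReal (‖h v‖ ^ (q / (q - 1))) *
            ENNReal.ofReal (|Real.sinh (u - v)| ^ (1 - q / (q - 1)))) ^ (q - 1) := by
  have hq1 : 0 < q - 1 := by linarith
  have hm : Measurable (Function.uncurry wavePair) := continuous_wavePair.measurable
  have he : ∀ z p, ‖wavePair z p‖ ≤ 1 := fun z p => (norm_wavePair z p).le
  have hL : ∀ G : ℝ × ℝ → ℂ, Integrable G pairMeasure →
      ∫⁻ z, ‖∫ p, wavePair z p * G p ∂pairMeasure‖ₑ ^ 2
        ≤ pairConst * ∫⁻ p, ‖G p‖ₑ ^ 2 ∂pairMeasure := fun G hG =>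
    lintegral_enorm_oscillatory_sq_le hm he
      (fun ψ h1 h2 => lintegral_pairMeasure_fourier_sq_le h1 h2) hG
  have hGm : Measurable (pairDensity g h) := by unfold pairDensity; fun_prop
  have key := lintegral_enorm_oscillatory_rpow_le (ν := (volume : Measure (ℝ × ℝ))) hm he hL
    pairConst_ne_top hq hGm (integrable_pairDensity hg hh)
  simp only [integral_pairDensity] at key
  refine key.trans (mul_le_mul_right (ENNReal.rpow_le_rpow ?_ hq1.le) _)
  exact lintegral_enorm_pairDensity_rpow_le hgm hhm (by positivity)

/-- In `sinh x = 2 sinh (x/2) cosh (x/2)` the first factor supplies the linear vanishing at zero and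
the second the exponential growth. Both are needed: one for the Riesz kernel, the other for decay
between caps. -/
theorem le_abs_sinh (w : ℝ) : |w| * Real.exp (|w| / 2) / 2 ≤ |Real.sinh w| := by
  rw [Real.abs_sinh]
  set x := |w| with hx
  have hx0 : 0 ≤ x / 2 := by positivity
  have h1 : Real.sinh x = 2 * Real.sinh (x / 2) * Real.cosh (x / 2) := by
    rw [← Real.sinh_two_mul]; congr 1; ring
  have h2 : x / 2 ≤ Real.sinh (x / 2) := Real.self_le_sinh_iff.2 hx0
  have h3 : Real.exp (x / 2) / 2 ≤ Real.cosh (x / 2) := by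
    rw [Real.cosh_eq]
    have := Real.exp_pos (-(x / 2))
    linarith
  rw [h1]
  calc x * Real.exp (x / 2) / 2 = 2 * (x / 2) * (Real.exp (x / 2) / 2) := by ring
    _ ≤ _ := by gcongr

theorem abs_sinh_rpow_le {α : ℝ} (hα : 0 < α) {j k : ℤ} {u v : ℝ} (hu : u ∈ unitCap j)
    (hv : v ∈ unitCap k) :
    |Real.sinh (u - v)| ^ (-α)
      ≤ 2 ^ α * Real.exp (α / 2) * Real.exp (-(α / 2 * |((j - k : ℤ) : ℝ)|)) * |u - v| ^ (-α) := by
  rcases eq_or_ne u v with h | h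
  -- On the diagonal both sides are zero, since `0 ^ (-α) = 0` by convention.
  · simp [h, Real.zero_rpow (neg_ne_zero.2 hα.ne')]
  have hw : 0 < |u - v| := abs_pos.2 (sub_ne_zero.2 h)
  -- Each point is within `1/2` of the centre of its cap; the lost 1 becomes the factor `exp (α/2)`.
  have hd : |((j - k : ℤ) : ℝ)| - 1 ≤ |u - v| := by
    obtain ⟨a1, a2⟩ := hu
    obtain ⟨b1, b2⟩ := hv
    push_cast
    have := abs_sub_abs_le_abs_sub ((j : ℝ) - k) (u - v)
    have h2 : |(j : ℝ) - k - (u - v)| ≤ 1 := by rw [abs_le]; constructor <;> linarith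
    linarith
  calc |Real.sinh (u - v)| ^ (-α)
      ≤ (|u - v| * Real.exp (|u - v| / 2) / 2) ^ (-α) :=
        Real.rpow_le_rpow_of_nonpos (by positivity) (le_abs_sinh _) (by linarith)
    _ = 2 ^ α * Real.exp (-(α / 2 * |u - v|)) * |u - v| ^ (-α) := by
        rw [Real.div_rpow (by positivity) (by norm_num), Real.mul_rpow hw.le (by positivity),
          ← Real.exp_mul, Real.rpow_neg (by norm_num : (0 : ℝ) ≤ 2), div_inv_eq_mul]
        rw [(by ring : |u - v| / 2 * -α = -(α / 2 * |u - v|))]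
        ring
    _ ≤ _ := by
        rw [mul_assoc (2 ^ α) (Real.exp (α / 2)), ← Real.exp_add]
        gcongr
        nlinarith

/-- The bilinear extension estimate for functions supported on two caps, with exponential decay
in the distance of the caps. -/
theorem exists_eLpNorm_waveIntegral_mul_le {q : ℝ} (hq : 2 < q) :
    ∃ C : ℝ≥0, ∀ (j k : ℤ) (g h : ℝ → ℂ), Measurable g → Measurable h → Integrable g →
      Integrable h → (∀ u ∉ unitCap j, g u = 0) → (∀ u ∉ unitCap k, h u = 0) →
      MemLp g (ENNReal.ofReal (2 * q / (2 * q - 3))) volume →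
      MemLp h (ENNReal.ofReal (2 * q / (2 * q - 3))) volume →
      eLpNorm (fun z => waveIntegral g z * waveIntegral h z) (ENNReal.ofReal q) volume
        ≤ C * ENNReal.ofReal (Real.exp (-(|((j - k : ℤ) : ℝ)| / (2 * q)))) *
          (eLpNorm g (ENNReal.ofReal (2 * q / (2 * q - 3))) volume *
            eLpNorm h (ENNReal.ofReal (2 * q / (2 * q - 3))) volume) := by
  have hq0 : 0 < q := by linarith
  have hq1 : 0 < q - 1 := by linarith
  have hq3 : 0 < 2 * q - 3 := by linarith
  -- This is `q' - 1`, the exponent of the singularity left by Hausdorff–Young; it is below 1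
  -- exactly because `q > 2`.
  set α := 1 / (q - 1) with hα
  have hα0 : 0 < α := by positivity
  have hα1 : α < 1 := by rw [hα, div_lt_one hq1]; linarith
  have hα2 : 0 < 2 - α := by linarith
  set r := 2 * q / (2 * q - 3) with hr
  have hr0 : 0 < r := by positivity
  have hq' : 1 - q / (q - 1) = -α := by rw [hα]; field_simp; ring
  -- Hardy–Littlewood–Sobolev takes `|g|^q'` in `L^(2/(2-α))`, that is, `g` in `L^r`.
  have hqr : q / (q - 1) * (2 / (2 - α)) = r := by
    have : 2 - α = (2 * q - 3) / (q - 1) := by rw [hα]; field_simp; ring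
    rw [this, hr]
    field_simp
  have hexp : (1 - α / 2) * (q - 1) * (1 / q) = 1 / r := by
    rw [hα, hr]; field_simp; ring
  set M := ENNReal.ofReal (q * (4 * (2 ^ (q - 2) / (q - 2)))) * pairConst with hM
  have hMt : M ≠ ⊤ := ENNReal.mul_ne_top ENNReal.ofReal_ne_top pairConst_ne_top
  set D := ENNReal.ofReal (2 ^ α * Real.exp (α / 2)) * rieszConst α with hD
  have hDt : D ≠ ⊤ := ENNReal.mul_ne_top ENNReal.ofReal_ne_top rieszConst_ne_top
  have hCt : (M * D ^ (q - 1)) ^ (1 / q) ≠ ⊤ := ENNReal.rpow_ne_top_of_nonneg (by positivity)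
    (ENNReal.mul_ne_top hMt (ENNReal.rpow_ne_top_of_nonneg hq1.le hDt))
  refine ⟨((M * D ^ (q - 1)) ^ (1 / q)).toNNReal, ?_⟩
  intro j k g h hgm hhm hg hh hgs hhs hgr hhr
  rw [ENNReal.coe_toNNReal hCt]
  have hrt : ENNReal.ofReal r ≠ ⊤ := ENNReal.ofReal_ne_top
  have hrz : ENNReal.ofReal r ≠ 0 := by simpa using hr0
  have hnorm : ∀ f : ℝ → ℂ, eLpNorm f (ENNReal.ofReal r) volume
      = (∫⁻ u, ENNReal.ofReal ((‖f u‖ ^ (q / (q - 1))) ^ (2 / (2 - α)))) ^ (1 / r) := by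
    intro f
    rw [eLpNorm_eq_lintegral_rpow_enorm_toReal hrz hrt, ENNReal.toReal_ofReal hr0.le]
    congr 1
    refine lintegral_congr fun u => ?_
    rw [← ofReal_norm, ENNReal.ofReal_rpow_of_nonneg (norm_nonneg _) hr0.le,
      ← Real.rpow_mul (norm_nonneg _), hqr]
  have hfin : ∀ f : ℝ → ℂ, MemLp f (ENNReal.ofReal r) volume →
      ∫⁻ u, ENNReal.ofReal ((‖f u‖ ^ (q / (q - 1))) ^ (2 / (2 - α))) ≠ ⊤ := by
    intro f hf htop
    have h1 := hf.2
    rw [hnorm, htop, ENNReal.top_rpow_of_pos (by positivity)] at h1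
    exact lt_irrefl _ h1
  set ρ := ENNReal.ofReal (Real.exp (-(α / 2 * |((j - k : ℤ) : ℝ)|))) with hρ
  have hkernel : ∫⁻ u, ENNReal.ofReal (‖g u‖ ^ (q / (q - 1))) *
        ∫⁻ v, ENNReal.ofReal (‖h v‖ ^ (q / (q - 1))) *
          ENNReal.ofReal (|Real.sinh (u - v)| ^ (1 - q / (q - 1)))
      ≤ D * ρ * (eLpNorm g (ENNReal.ofReal r) volume ^ (r * (1 - α / 2)) *
        eLpNorm h (ENNReal.ofReal r) volume ^ (r * (1 - α / 2))) := by
    rw [hq']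
    calc _ ≤ ∫⁻ u, (ENNReal.ofReal (2 ^ α * Real.exp (α / 2)) * ρ) *
          (ENNReal.ofReal (‖g u‖ ^ (q / (q - 1))) *
          ∫⁻ v, ENNReal.ofReal (‖h v‖ ^ (q / (q - 1))) * ENNReal.ofReal (|u - v| ^ (-α))) := by
          refine lintegral_mono fun u => ?_
          by_cases hu : u ∈ unitCap j
          · simp only
            rw [mul_left_comm]
            refine mul_le_mul_right ?_ _
            rw [← lintegral_const_mul _ (by fun_prop)]
            refine lintegral_mono fun v => ?_
            by_cases hv : v ∈ unitCap k
            · simp only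
              rw [mul_left_comm]
              refine mul_le_mul_right ?_ _
              rw [hρ, ← ENNReal.ofReal_mul (by positivity), ← ENNReal.ofReal_mul (by positivity)]
              exact ENNReal.ofReal_le_ofReal (abs_sinh_rpow_le hα0 hu hv)
            · simp only [hhs v hv, norm_zero]
              rw [Real.zero_rpow (by positivity)]
              simp
          · simp only [hgs u hu, norm_zero]
            rw [Real.zero_rpow (by positivity)]
            simp
      _ ≤ (ENNReal.ofReal (2 ^ α * Real.exp (α / 2)) * ρ) * (rieszConst α * _) := by
          rw [lintegral_const_mul' _ _ (ENNReal.mul_ne_top ENNReal.ofReal_ne_top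
            ENNReal.ofReal_ne_top)]
          exact mul_le_mul_right (lintegral_lintegral_rieszKernel_le hα0 hα1
            (hgm.norm.pow_const _) (hhm.norm.pow_const _) (fun _ => by positivity)
            (fun _ => by positivity) (hfin g hgr) (hfin h hhr)) _
      _ = _ := by
          rw [hnorm, hnorm, ← ENNReal.rpow_mul, ← ENNReal.rpow_mul, ← mul_assoc (1 / r),
            one_div_mul_cancel hr0.ne', one_mul]
          ring
  have hmain := lintegral_enorm_waveIntegral_mul_rpow_le hgm hhm hg hh hq
  rw [eLpNorm_eq_lintegral_rpow_enorm_toReal (by simpa using hq0) ENNReal.ofReal_ne_top,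
    ENNReal.toReal_ofReal hq0.le]
  calc (∫⁻ z, ‖waveIntegral g z * waveIntegral h z‖ₑ ^ q) ^ (1 / q)
      ≤ (M * (D * ρ * (eLpNorm g (ENNReal.ofReal r) volume ^ (r * (1 - α / 2)) *
        eLpNorm h (ENNReal.ofReal r) volume ^ (r * (1 - α / 2)))) ^ (q - 1)) ^ (1 / q) := by
        gcongr
        exact hmain.trans (mul_le_mul_right (ENNReal.rpow_le_rpow hkernel hq1.le) _)
    _ = (M * D ^ (q - 1)) ^ (1 / q) * ρ ^ ((q - 1) * (1 / q)) *
        (eLpNorm g (ENNReal.ofReal r) volume ^ (r * ((1 - α / 2) * (q - 1) * (1 / q))) *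
        eLpNorm h (ENNReal.ofReal r) volume ^ (r * ((1 - α / 2) * (q - 1) * (1 / q)))) := by
        have hi : 0 ≤ 1 / q := by positivity
        simp only [ENNReal.mul_rpow_of_nonneg _ _ hq1.le, ENNReal.mul_rpow_of_nonneg _ _ hi,
          ← ENNReal.rpow_mul, ← mul_assoc]
    _ = _ := by
        -- The decay `exp (-(α/2)|j-k|)` is raised to the power `(q-1)/q`, and `α (q-1) = 1` leaves
        -- the rate `1/(2q)`.
        rw [hexp, mul_one_div_cancel hr0.ne', ENNReal.rpow_one, ENNReal.rpow_one, hρ,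
          ENNReal.ofReal_rpow_of_pos (Real.exp_pos _), ← Real.exp_mul]
        congr 4
        rw [hα]
        field_simp

end Bilinear

/-! ### Summation over caps through a trilinear form. -/

theorem mul_mul_le_add_cube (a b c : ℝ≥0∞) : a * b * c ≤ a ^ 3 + b ^ 3 + c ^ 3 := by
  set m := max (max a b) c with hm
  have ha : a ≤ m := (le_max_left _ _).trans (le_max_left _ _)
  have hb : b ≤ m := (le_max_right _ _).trans (le_max_left _ _)
  have hc : c ≤ m := le_max_right _ _
  calc a * b * c ≤ m * m * m := mul_le_mul' (mul_le_mul' ha hb) hc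
    _ = m ^ 3 := by ring
    _ ≤ _ := by
      rcases max_choice (max a b) c with h | h
      · rcases max_choice a b with h' | h'
        · rw [hm, h, h', add_assoc]; exact le_self_add
        · rw [hm, h, h', add_right_comm]; exact le_add_self
      · rw [hm, h]; exact le_add_self

/-- Schur's test for a trilinear form. -/
theorem sum_trilinear_le (S : Finset ℤ) {ρ : ℤ → ℝ≥0∞} (hρ : ∀ m, ρ (-m) = ρ m)
    (a : ℤ → ℝ≥0∞) :
    ∑ j ∈ S, ∑ k ∈ S, ∑ l ∈ S, ρ (j - k) * ρ (k - l) * (a j * a k * a l)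
      ≤ 3 * (∑' m, ρ m) ^ 2 * ∑ k ∈ S, a k ^ 3 := by
  set R := ∑' m, ρ m with hR
  have h1 : ∀ j, ∑ k ∈ S, ρ (j - k) ≤ R := fun j => by
    refine (ENNReal.sum_le_tsum S).trans_eq ?_
    exact (Equiv.subLeft j).tsum_eq ρ
  have h2 : ∀ k, ∑ j ∈ S, ρ (j - k) ≤ R := fun k => by
    refine le_of_eq_of_le (Finset.sum_congr rfl fun j _ => ?_) (h1 k)
    rw [← hρ, neg_sub]
  -- The weights link the indices in a chain `j`, `k`, `l`. Whichever index carries the cube, the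
  -- other two can be summed out starting from the ends, each at a cost of `R`.
  have e1 : ∑ j ∈ S, ∑ k ∈ S, ∑ l ∈ S, ρ (j - k) * ρ (k - l) * a j ^ 3 ≤ R ^ 2 * ∑ j ∈ S, a j ^ 3 := by
    rw [Finset.mul_sum]
    refine Finset.sum_le_sum fun j _ => ?_
    simp only [← Finset.sum_mul]
    gcongr
    calc ∑ k ∈ S, ∑ l ∈ S, ρ (j - k) * ρ (k - l) ≤ ∑ k ∈ S, ρ (j - k) * R := by
          refine Finset.sum_le_sum fun k _ => ?_
          rw [← Finset.mul_sum]
          gcongr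
          exact h1 k
      _ ≤ R ^ 2 := by
          rw [← Finset.sum_mul, sq]
          gcongr
          exact h1 j
  have e2 : ∑ j ∈ S, ∑ k ∈ S, ∑ l ∈ S, ρ (j - k) * ρ (k - l) * a k ^ 3 ≤ R ^ 2 * ∑ j ∈ S, a j ^ 3 := by
    rw [Finset.sum_comm, Finset.mul_sum]
    refine Finset.sum_le_sum fun k _ => ?_
    simp only [← Finset.sum_mul]
    gcongr
    rw [← Finset.sum_mul_sum, sq]
    gcongr
    · exact h2 k
    · exact h1 k
  have e3 : ∑ j ∈ S, ∑ k ∈ S, ∑ l ∈ S, ρ (j - k) * ρ (k - l) * a l ^ 3 ≤ R ^ 2 * ∑ j ∈ S, a j ^ 3 := by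
    have : ∑ j ∈ S, ∑ k ∈ S, ∑ l ∈ S, ρ (j - k) * ρ (k - l) * a l ^ 3
        = ∑ l ∈ S, (∑ k ∈ S, (∑ j ∈ S, ρ (j - k)) * ρ (k - l)) * a l ^ 3 := by
      simp only [Finset.sum_mul]
      calc _ = ∑ j ∈ S, ∑ l ∈ S, ∑ k ∈ S, ρ (j - k) * ρ (k - l) * a l ^ 3 :=
            Finset.sum_congr rfl fun j _ => Finset.sum_comm
        _ = ∑ l ∈ S, ∑ j ∈ S, ∑ k ∈ S, ρ (j - k) * ρ (k - l) * a l ^ 3 := Finset.sum_comm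
        _ = _ := Finset.sum_congr rfl fun l _ => Finset.sum_comm
    rw [this, Finset.mul_sum]
    refine Finset.sum_le_sum fun l _ => ?_
    gcongr
    calc ∑ k ∈ S, (∑ j ∈ S, ρ (j - k)) * ρ (k - l) ≤ ∑ k ∈ S, R * ρ (k - l) := by
          refine Finset.sum_le_sum fun k _ => ?_
          gcongr
          exact h2 k
      _ ≤ R ^ 2 := by
          rw [← Finset.mul_sum, sq]
          gcongr
          exact h2 l
  calc _ ≤ ∑ j ∈ S, ∑ k ∈ S, ∑ l ∈ S, ρ (j - k) * ρ (k - l) * (a j ^ 3 + a k ^ 3 + a l ^ 3) := by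
        gcongr
        exact mul_mul_le_add_cube _ _ _
    _ ≤ R ^ 2 * ∑ j ∈ S, a j ^ 3 + R ^ 2 * ∑ j ∈ S, a j ^ 3 + R ^ 2 * ∑ j ∈ S, a j ^ 3 := by
        simp only [mul_add, Finset.sum_add_distrib]
        exact add_le_add (add_le_add e1 e2) e3
    _ = _ := by ring

/-- Hölder's inequality for a product of three functions, in terms of the products of two. -/
theorem eLpNorm_mul_mul_le {X : Type*} [MeasurableSpace X] {μ : Measure X} {F G H : X → ℂ}
    (hF : AEStronglyMeasurable F μ) (hG : AEStronglyMeasurable G μ)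
    (hH : AEStronglyMeasurable H μ) {q : ℝ} (hq : 0 < q) :
    eLpNorm (fun x => F x * G x * H x) (ENNReal.ofReal (2 * q / 3)) μ
      ≤ eLpNorm (fun x => F x * G x) (ENNReal.ofReal q) μ ^ (1 / 2 : ℝ) *
        eLpNorm (fun x => G x * H x) (ENNReal.ofReal q) μ ^ (1 / 2 : ℝ) *
        eLpNorm (fun x => H x * F x) (ENNReal.ofReal q) μ ^ (1 / 2 : ℝ) := by
  have hs : 0 < 2 * q / 3 := by positivity
  simp only [eLpNorm_eq_lintegral_rpow_enorm_toReal
    (show ENNReal.ofReal q ≠ 0 by simpa using hq) ENNReal.ofReal_ne_top,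
    eLpNorm_eq_lintegral_rpow_enorm_toReal
    (show ENNReal.ofReal (2 * q / 3) ≠ 0 by simpa using hq) ENNReal.ofReal_ne_top,
    ENNReal.toReal_ofReal hq.le, ENNReal.toReal_ofReal hs.le]
  have key := ENNReal.lintegral_prod_norm_pow_le (μ := μ) (Finset.univ : Finset (Fin 3))
    (f := ![fun x => ‖F x * G x‖ₑ ^ q, fun x => ‖G x * H x‖ₑ ^ q, fun x => ‖H x * F x‖ₑ ^ q])
    (p := fun _ => 1 / 3) (by
      intro i _
      fin_cases i
      · exact (hF.mul hG).enorm.pow_const q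
      · exact (hG.mul hH).enorm.pow_const q
      · exact (hH.mul hF).enorm.pow_const q) (by simp) (by intros; norm_num)
  simp only [Fin.prod_univ_three, Matrix.cons_val_zero, Matrix.cons_val_one, Matrix.cons_val] at key
  -- This is `(FG)(GH)(HF) = (FGH)²` raised to the power `q/3`.
  have hpt : ∀ x, (‖F x * G x‖ₑ ^ q) ^ (1 / 3 : ℝ) * (‖G x * H x‖ₑ ^ q) ^ (1 / 3 : ℝ) *
      (‖H x * F x‖ₑ ^ q) ^ (1 / 3 : ℝ) = ‖F x * G x * H x‖ₑ ^ (2 * q / 3) := by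
    intro x
    have h3 : (0 : ℝ) ≤ 1 / 3 := by norm_num
    rw [← ENNReal.mul_rpow_of_nonneg _ _ h3, ← ENNReal.mul_rpow_of_nonneg _ _ h3,
      ← ENNReal.mul_rpow_of_nonneg _ _ hq.le, ← ENNReal.mul_rpow_of_nonneg _ _ hq.le,
      ← ENNReal.rpow_mul, (by ring : 2 * q / 3 = 2 * (q * (1 / 3))),
      ENNReal.rpow_mul _ 2]
    congr 1
    simp only [enorm_mul, ENNReal.rpow_ofNat]
    ring
  simp only [hpt] at key
  refine (ENNReal.rpow_le_rpow key (by positivity)).trans_eq ?_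
  have hp : 0 ≤ 1 / (2 * q / 3) := by positivity
  rw [ENNReal.mul_rpow_of_nonneg _ _ hp, ENNReal.mul_rpow_of_nonneg _ _ hp]
  simp only [← ENNReal.rpow_mul]
  have : (1 / 3 : ℝ) * (1 / (2 * q / 3)) = 1 / q * (1 / 2) := by field_simp
  rw [this]

theorem eLpNorm_fun_sum_le {X ι : Type*} [MeasurableSpace X] {μ : Measure X} {F : ι → X → ℂ}
    {S : Finset ι} (hF : ∀ i ∈ S, AEStronglyMeasurable (F i) μ) {p : ℝ≥0∞} (hp : 1 ≤ p) :
    eLpNorm (fun x => ∑ i ∈ S, F i x) p μ ≤ ∑ i ∈ S, eLpNorm (F i) p μ := by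
  have h := eLpNorm_sum_le hF hp
  rwa [Finset.sum_fn] at h

theorem tsum_ofReal_exp_ne_top {c : ℝ} (hc : 0 < c) :
    ∑' m : ℤ, ENNReal.ofReal (Real.exp (-(|(m : ℝ)| * c))) ≠ ⊤ := by
  have hnat : Summable fun n : ℕ => Real.exp (-((n : ℝ) * c)) := by
    have := summable_geometric_of_lt_one (Real.exp_pos (-c)).le (Real.exp_lt_one_iff.2 (by linarith))
    refine this.congr fun n => ?_
    rw [← Real.exp_nat_mul]
    congr 1
    ring
  have hs : Summable fun m : ℤ => Real.exp (-(|(m : ℝ)| * c)) := by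
    refine Summable.of_nat_of_neg ?_ ?_ <;> simpa using hnat
  exact hs.tsum_ofReal_ne_top

theorem waveIntegral_sum {g : ℤ → ℝ → ℂ} (hg : ∀ k, Integrable (g k)) (S : Finset ℤ)
    (z : ℝ × ℝ) :
    waveIntegral (fun u => ∑ k ∈ S, g k u) z = ∑ k ∈ S, waveIntegral (g k) z := by
  simp only [waveIntegral, Finset.mul_sum]
  refine integral_finsetSum S fun k _ => ?_
  exact integrable_mul_of_bounded continuous_wave.measurable (fun z u => (norm_wave z u).le)
    (hg k) z

/-- The refined extension inequality for finitely many caps. -/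
theorem exists_eLpNorm_waveIntegral_sum_le {q : ℝ} (hq : 3 ≤ q) :
    ∃ C : ℝ≥0, ∀ (g : ℤ → ℝ → ℂ), (∀ k, Measurable (g k)) → (∀ k, Integrable (g k)) →
      (∀ k, ∀ u ∉ unitCap k, g k u = 0) →
      (∀ k, MemLp (g k) (ENNReal.ofReal (2 * q / (2 * q - 3))) volume) → ∀ S : Finset ℤ,
      eLpNorm (waveIntegral fun u => ∑ k ∈ S, g k u) (ENNReal.ofReal (2 * q)) volume
        ≤ C * (∑ k ∈ S, eLpNorm (g k) (ENNReal.ofReal (2 * q / (2 * q - 3))) volume ^ (3 : ℕ))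
          ^ (1 / 3 : ℝ) := by
  obtain ⟨C, hC⟩ := exists_eLpNorm_waveIntegral_mul_le (q := q) (by linarith)
  have hq0 : 0 < q := by linarith
  -- Half the bilinear decay rate, because each pair enters the Hölder bound with a square root.
  set c := 1 / (4 * q) with hc
  have hc0 : 0 < c := by positivity
  set ρ : ℤ → ℝ≥0∞ := fun m => ENNReal.ofReal (Real.exp (-(|(m : ℝ)| * c))) with hρ
  have hρ1 : ∀ m, ρ m ≤ 1 := fun m => by
    rw [hρ, ENNReal.ofReal_le_one, Real.exp_le_one_iff, neg_nonpos]
    positivity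
  have hρe : ∀ m, ρ (-m) = ρ m := fun m => by simp [hρ]
  set R := ∑' m, ρ m with hR
  have hRt : R ≠ ⊤ := tsum_ofReal_exp_ne_top hc0
  set K : ℝ≥0∞ := (C : ℝ≥0∞) ^ (3 / 2 : ℝ) * (3 * R ^ 2) with hK
  have hKt : K ^ (1 / 3 : ℝ) ≠ ⊤ := ENNReal.rpow_ne_top_of_nonneg (by norm_num)
    (ENNReal.mul_ne_top (ENNReal.rpow_ne_top_of_nonneg (by norm_num) ENNReal.coe_ne_top)
      (ENNReal.mul_ne_top (by simp) (ENNReal.pow_ne_top hRt)))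
  refine ⟨(K ^ (1 / 3 : ℝ)).toNNReal, fun g hgm hgi hgs hgr S => ?_⟩
  rw [ENNReal.coe_toNNReal hKt, ← ENNReal.mul_rpow_of_nonneg _ _ (by norm_num)]
  set r := ENNReal.ofReal (2 * q / (2 * q - 3)) with hr
  set a : ℤ → ℝ≥0∞ := fun k => eLpNorm (g k) r volume with ha
  set E : ℤ → ℝ × ℝ → ℂ := fun k => waveIntegral (g k) with hE
  have hEc : ∀ k, AEStronglyMeasurable (E k) volume := fun k =>
    (continuous_waveIntegral (hgi k)).aestronglyMeasurable
  have hbil : ∀ j k, eLpNorm (fun z => E j z * E k z) (ENNReal.ofReal q) volume ^ (1 / 2 : ℝ)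
      ≤ (C : ℝ≥0∞) ^ (1 / 2 : ℝ) * ρ (j - k) * (a j * a k) ^ (1 / 2 : ℝ) := by
    intro j k
    have h2 : (0 : ℝ) ≤ 1 / 2 := by norm_num
    refine (ENNReal.rpow_le_rpow (hC j k (g j) (g k) (hgm j) (hgm k) (hgi j) (hgi k) (hgs j) (hgs k)
      (hgr j) (hgr k)) h2).trans_eq ?_
    rw [ENNReal.mul_rpow_of_nonneg _ _ h2, ENNReal.mul_rpow_of_nonneg _ _ h2,
      ENNReal.ofReal_rpow_of_pos (Real.exp_pos _), ← Real.exp_mul]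
    congr 4
    rw [hc]
    field_simp
    norm_num
  have htri : ∀ j k l, eLpNorm (fun z => E j z * E k z * E l z) (ENNReal.ofReal (2 * q / 3)) volume
      ≤ (C : ℝ≥0∞) ^ (3 / 2 : ℝ) * (ρ (j - k) * ρ (k - l) * (a j * a k * a l)) := by
    intro j k l
    refine (eLpNorm_mul_mul_le (hEc j) (hEc k) (hEc l) hq0).trans ?_
    refine (mul_le_mul' (mul_le_mul' (hbil j k) (hbil k l)) (hbil l j)).trans ?_
    have h2 : (0 : ℝ) ≤ 1 / 2 := by norm_num
    calc _ = ((C : ℝ≥0∞) ^ (1 / 2 : ℝ) * (C : ℝ≥0∞) ^ (1 / 2 : ℝ) * (C : ℝ≥0∞) ^ (1 / 2 : ℝ)) *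
          (ρ (j - k) * ρ (k - l) * ρ (l - j) *
            ((a j * a k) ^ (1 / 2 : ℝ) * (a k * a l) ^ (1 / 2 : ℝ) * (a l * a j) ^ (1 / 2 : ℝ))) := by
          ring
      _ = (C : ℝ≥0∞) ^ (3 / 2 : ℝ) * (ρ (j - k) * ρ (k - l) * ρ (l - j) * (a j * a k * a l)) := by
          rw [← ENNReal.rpow_add_of_nonneg _ _ h2 h2,
            ← ENNReal.rpow_add_of_nonneg _ _ (by norm_num) h2,
            ← ENNReal.mul_rpow_of_nonneg _ _ h2, ← ENNReal.mul_rpow_of_nonneg _ _ h2,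
            (by ring : a j * a k * (a k * a l) * (a l * a j) = (a j * a k * a l) ^ 2),
            ← ENNReal.rpow_two, ← ENNReal.rpow_mul]
          norm_num
      _ ≤ _ := by
          -- The factor `ρ (l - j)` is discarded; two links already suffice to sum over three
          -- indices.
          exact mul_le_mul_right (mul_le_mul_left
            (mul_le_of_le_one_right zero_le (hρ1 _)) _) _
  set s := ENNReal.ofReal (2 * q / 3) with hs
  -- The triangle inequality for the expanded cube needs `2q/3 ≥ 1`.
  have hs1 : 1 ≤ s := by
    rw [hs, ENNReal.one_le_ofReal]; linarith
  have hcube : eLpNorm (waveIntegral fun u => ∑ k ∈ S, g k u) (ENNReal.ofReal (2 * q)) volume ^ (3 : ℝ)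
      = eLpNorm (fun z => ∑ j ∈ S, ∑ k ∈ S, ∑ l ∈ S, E j z * E k z * E l z) s volume := by
    have h1 := eLpNorm_norm_rpow (waveIntegral fun u => ∑ k ∈ S, g k u) (p := s)
      (μ := volume) (q := 3) (by norm_num)
    rw [hs, ← ENNReal.ofReal_mul (by positivity), (by ring : 2 * q / 3 * 3 = 2 * q)] at h1
    rw [← h1, ← hs]
    refine eLpNorm_congr_norm_ae (Filter.Eventually.of_forall fun z => ?_)
    have : ∑ j ∈ S, ∑ k ∈ S, ∑ l ∈ S, E j z * E k z * E l z
        = (waveIntegral (fun u => ∑ k ∈ S, g k u) z) ^ 3 := by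
      rw [waveIntegral_sum hgi, pow_succ, sq, Finset.sum_mul_sum, Finset.sum_mul]
      refine Finset.sum_congr rfl fun j _ => ?_
      rw [Finset.sum_mul]
      refine Finset.sum_congr rfl fun k _ => ?_
      rw [Finset.mul_sum]
    rw [this, norm_pow]
    simp
  have hfinal : eLpNorm (waveIntegral fun u => ∑ k ∈ S, g k u) (ENNReal.ofReal (2 * q)) volume
      ^ (3 : ℝ) ≤ K * ∑ k ∈ S, a k ^ 3 := by
    rw [hcube]
    have hm3 : ∀ j k l, AEStronglyMeasurable (fun z => E j z * E k z * E l z) volume :=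
      fun j k l => ((hEc j).mul (hEc k)).mul (hEc l)
    have hm2 : ∀ j k, AEStronglyMeasurable (fun z => ∑ l ∈ S, E j z * E k z * E l z) volume :=
      fun j k => Finset.aestronglyMeasurable_fun_sum S fun l _ => hm3 j k l
    have hm1 : ∀ j, AEStronglyMeasurable (fun z => ∑ k ∈ S, ∑ l ∈ S, E j z * E k z * E l z) volume :=
      fun j => Finset.aestronglyMeasurable_fun_sum S fun k _ => hm2 j k
    calc _ ≤ ∑ j ∈ S, ∑ k ∈ S, ∑ l ∈ S, eLpNorm (fun z => E j z * E k z * E l z) s volume := by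
          refine (eLpNorm_fun_sum_le (fun j _ => hm1 j) hs1).trans (Finset.sum_le_sum fun j _ => ?_)
          refine (eLpNorm_fun_sum_le (fun k _ => hm2 j k) hs1).trans (Finset.sum_le_sum fun k _ => ?_)
          exact eLpNorm_fun_sum_le (fun l _ => hm3 j k l) hs1
      _ ≤ ∑ j ∈ S, ∑ k ∈ S, ∑ l ∈ S,
          (C : ℝ≥0∞) ^ (3 / 2 : ℝ) * (ρ (j - k) * ρ (k - l) * (a j * a k * a l)) := by
          gcongr with j _ k _ l _
          exact htri j k l
      _ = (C : ℝ≥0∞) ^ (3 / 2 : ℝ) * ∑ j ∈ S, ∑ k ∈ S, ∑ l ∈ S,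
          ρ (j - k) * ρ (k - l) * (a j * a k * a l) := by
          simp only [Finset.mul_sum]
      _ ≤ _ := by
          rw [hK, mul_assoc]
          gcongr
          exact sum_trilinear_le S hρe a
  have := ENNReal.rpow_le_rpow hfinal (by norm_num : (0 : ℝ) ≤ 1 / 3)
  rwa [← ENNReal.rpow_mul, (by norm_num : (3 : ℝ) * (1 / 3) = 1), ENNReal.rpow_one] at this

/-! ### The coordinate `u = arsinh y` and norms over caps. -/

/-- The derivative of `arsinh` is `1/√(1+y²)`, exactly the density of `sigma`. This carries every
norm on the hyperbola over to Lebesgue measure on the line. -/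
theorem measurePreserving_sinh : MeasurePreserving Real.sinh volume sigma := by
  refine ⟨Real.continuous_sinh.measurable, Measure.ext fun s hs => ?_⟩
  rw [Measure.map_apply Real.continuous_sinh.measurable hs, sigma, withDensity_apply _ hs]
  have himage : Real.sinh ⁻¹' s = Real.arsinh '' s := by
    ext u
    constructor
    · intro hu
      exact ⟨Real.sinh u, hu, Real.arsinh_sinh u⟩
    · rintro ⟨y, hy, rfl⟩
      simpa using hy
  have h := lintegral_image_eq_lintegral_abs_deriv_mul hs
    (fun y _ => (Real.hasDerivAt_arsinh y).hasDerivWithinAt) Real.arsinh_injective.injOn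
    (fun _ => 1)
  rw [himage, ← setLIntegral_one, h]
  refine lintegral_congr fun y => ?_
  rw [mul_one, bracket, one_div, abs_of_nonneg (by positivity)]

theorem measurableEmbedding_sinh : MeasurableEmbedding Real.sinh :=
  Real.sinhHomeomorph.measurableEmbedding

theorem cap_indicator_comp_sinh (f : ℝ → ℂ) (k : ℤ) :
    (cap k).indicator f ∘ Real.sinh = (unitCap k).indicator (f ∘ Real.sinh) := by
  classical
  funext u
  have : Real.sinh u ∈ cap k ↔ u ∈ unitCap k := by
    simp only [cap, unitCap, Set.mem_Ico, Real.sinh_le_sinh, Real.sinh_lt_sinh]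
  simp only [Function.comp_apply, Set.indicator_apply, this]

theorem eLpNorm_cap_indicator {f : ℝ → ℂ} (hf : AEStronglyMeasurable f sigma) (k : ℤ)
    (p : ℝ≥0∞) :
    eLpNorm ((cap k).indicator f) p sigma
      = eLpNorm ((unitCap k).indicator (f ∘ Real.sinh)) p volume := by
  rw [← cap_indicator_comp_sinh]
  exact (eLpNorm_comp_measurePreserving (hf.indicator measurableSet_Ico)
    measurePreserving_sinh).symm

theorem mem_unitCap_iff {u : ℝ} {k : ℤ} : u ∈ unitCap k ↔ ⌊u + 1 / 2⌋ = k := by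
  rw [Int.floor_eq_iff, unitCap, Set.mem_Ico]
  constructor <;> rintro ⟨h1, h2⟩ <;> constructor <;> linarith

/-- The union of the caps with index in `[-n, n]`. -/
def capWindow (n : ℕ) : Set ℝ := {u | ⌊u + 1 / 2⌋ ∈ Finset.Icc (-(n : ℤ)) n}

theorem measurableSet_capWindow (n : ℕ) : MeasurableSet (capWindow n) := by
  have hm : Measurable fun u : ℝ => ⌊u + 1 / 2⌋ := by fun_prop
  exact hm (Finset.measurableSet _)

theorem capWindow_mono : Monotone capWindow := by
  intro n m hnm u hu
  simp only [capWindow, Set.mem_ofPred_eq, Finset.mem_Icc] at hu ⊢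
  omega

theorem exists_mem_capWindow (u : ℝ) : ∃ n, u ∈ capWindow n := by
  refine ⟨⌊u + 1 / 2⌋.natAbs, ?_⟩
  simp only [capWindow, Set.mem_ofPred_eq, Finset.mem_Icc]
  omega

theorem sum_unitCap_indicator {g : ℝ → ℂ} {n : ℕ} (hg : ∀ u ∉ capWindow n, g u = 0) :
    (fun u => ∑ k ∈ Finset.Icc (-(n : ℤ)) n, (unitCap k).indicator g u) = g := by
  classical
  funext u
  simp only [Set.indicator_apply, mem_unitCap_iff, Finset.sum_ite_eq]
  split_ifs with h
  · rfl
  · exact (hg u h).symm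

theorem volume_unitCap (k : ℤ) : volume (unitCap k) = 1 := by
  rw [unitCap, Real.volume_Ico]
  norm_num

instance (k : ℤ) : IsProbabilityMeasure ((volume : Measure ℝ).restrict (unitCap k)) :=
  ⟨by rw [Measure.restrict_apply_univ, volume_unitCap]⟩

theorem eLpNorm_unitCap_mono {g : ℝ → ℂ} (hg : AEStronglyMeasurable g volume) (k : ℤ)
    {p s : ℝ≥0∞} (hps : p ≤ s) :
    eLpNorm ((unitCap k).indicator g) p volume ≤ eLpNorm ((unitCap k).indicator g) s volume := by
  rw [eLpNorm_indicator_eq_eLpNorm_restrict (measurableSet_unitCap k),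
    eLpNorm_indicator_eq_eLpNorm_restrict (measurableSet_unitCap k)]
  exact eLpNorm_le_eLpNorm_of_exponent_le hps hg.restrict

theorem memLp_unitCap {g : ℝ → ℂ} (hg : MemLp g 2 volume) (k : ℤ) {p : ℝ≥0∞} (hp : p ≤ 2) :
    MemLp ((unitCap k).indicator g) p volume :=
  ⟨hg.1.indicator (measurableSet_unitCap k), (eLpNorm_unitCap_mono hg.1 k hp).trans_lt
    (hg.indicator (measurableSet_unitCap k)).2⟩

theorem tsum_eLpNorm_unitCap_sq_le (g : ℝ → ℂ) :
    ∑' k : ℤ, eLpNorm ((unitCap k).indicator g) 2 volume ^ 2 ≤ eLpNorm g 2 volume ^ 2 := by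
  have hd : Pairwise (Function.onFun Disjoint unitCap) := by
    intro j k hjk
    refine Set.disjoint_left.2 fun u hu hv => hjk ?_
    rw [← mem_unitCap_iff.1 hu, ← mem_unitCap_iff.1 hv]
  have e : ∀ k : ℤ, eLpNorm ((unitCap k).indicator g) 2 volume ^ 2
      = ∫⁻ u in unitCap k, ‖g u‖ₑ ^ 2 := fun k => by
    rw [eLpNorm_indicator_eq_eLpNorm_restrict (measurableSet_unitCap k),
      eLpNorm_two_sq_eq_lintegral]
  simp only [e]
  rw [← lintegral_iUnion measurableSet_unitCap hd, eLpNorm_two_sq_eq_lintegral]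
  exact setLIntegral_le_lintegral _ _

theorem tsum_cube_le (a : ℤ → ℝ≥0∞) : ∑' k, a k ^ 3 ≤ (⨆ k, a k) * ∑' k, a k ^ 2 := by
  rw [← ENNReal.tsum_mul_left]
  refine ENNReal.tsum_le_tsum fun k => ?_
  rw [pow_succ']
  gcongr
  exact le_iSup a k

/-- This is where `q ≥ 3` is essential: `L²` on a cap of measure one then embeds into the `L^r` of
the refined inequality. Equality at `q = 3` gives the `L²`–`L⁶` bound. -/
theorem two_mul_div_le_two {q : ℝ} (hq : 3 ≤ q) :
    ENNReal.ofReal (2 * q / (2 * q - 3)) ≤ 2 := by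
  rw [← ENNReal.ofReal_ofNat 2]
  refine ENNReal.ofReal_le_ofReal ?_
  rw [div_le_iff₀ (by linarith)]
  linarith

/-- The norm on the right hand side of the refined extension inequality. -/
def capNorm (g : ℝ → ℂ) (p : ℝ≥0∞) : ℝ≥0∞ :=
  (∑' k : ℤ, eLpNorm ((unitCap k).indicator g) p volume ^ (3 : ℕ)) ^ (1 / 3 : ℝ)

/-- On caps of measure one the `L^p` norm is at most the `L²` norm. The `ℓ³` norm over caps is then
interpolated between `ℓ^∞` and `ℓ²`, the latter being controlled by the global `L²` norm because the
caps are disjoint. -/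
theorem capNorm_le {g : ℝ → ℂ} (hg : AEStronglyMeasurable g volume) {p : ℝ≥0∞} (hp : p ≤ 2) :
    capNorm g p ≤ (⨆ k : ℤ, eLpNorm ((unitCap k).indicator g) 2 volume ^ (1 / 3 : ℝ)) *
      eLpNorm g 2 volume ^ (2 / 3 : ℝ) := by
  set a : ℤ → ℝ≥0∞ := fun k => eLpNorm ((unitCap k).indicator g) 2 volume with ha
  have h3 : (0 : ℝ) < 1 / 3 := by norm_num
  calc capNorm g p ≤ ((⨆ k, a k) * eLpNorm g 2 volume ^ 2) ^ (1 / 3 : ℝ) := by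
        refine ENNReal.rpow_le_rpow ?_ h3.le
        calc _ ≤ ∑' k, a k ^ 3 := ENNReal.tsum_le_tsum fun k => by
              gcongr
              exact eLpNorm_unitCap_mono hg k hp
          _ ≤ _ := (tsum_cube_le a).trans (mul_le_mul_right (tsum_eLpNorm_unitCap_sq_le g) _)
    _ = _ := by
        rw [ENNReal.mul_rpow_of_nonneg _ _ h3.le, ← ENNReal.rpow_two, ← ENNReal.rpow_mul]
        congr 1
        · exact (ENNReal.orderIsoRpow _ h3).map_iSup a
        · norm_num

theorem capNorm_le_eLpNorm {g : ℝ → ℂ} (hg : AEStronglyMeasurable g volume) {p : ℝ≥0∞}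
    (hp : p ≤ 2) : capNorm g p ≤ eLpNorm g 2 volume := by
  refine (capNorm_le hg hp).trans ?_
  calc _ ≤ eLpNorm g 2 volume ^ (1 / 3 : ℝ) * eLpNorm g 2 volume ^ (2 / 3 : ℝ) := by
        gcongr
        exact iSup_le fun k => ENNReal.rpow_le_rpow (eLpNorm_indicator_le _) (by norm_num)
    _ = _ := by
        rw [← ENNReal.rpow_add_of_nonneg _ _ (by norm_num) (by norm_num)]
        norm_num

/-- Makes the bounds for truncations uniform in the truncation. -/
theorem capNorm_indicator_le (g : ℝ → ℂ) (s : Set ℝ) (p : ℝ≥0∞) :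
    capNorm (s.indicator g) p ≤ capNorm g p := by
  unfold capNorm
  gcongr with k
  refine eLpNorm_mono fun u => ?_
  by_cases h1 : u ∈ unitCap k <;> by_cases h2 : u ∈ s <;> simp [h1, h2]

theorem integrable_of_capWindow {g : ℝ → ℂ} (hg : MemLp g 2 volume) {n : ℕ}
    (hn : ∀ u ∉ capWindow n, g u = 0) : Integrable g := by
  rw [← sum_unitCap_indicator hn]
  exact integrable_finsetSum _ fun k _ => memLp_one_iff_integrable.1 (memLp_unitCap hg k (by simp))

/-- The refined extension inequality for functions supported on finitely many caps. -/
theorem exists_eLpNorm_waveIntegral_le {q : ℝ} (hq : 3 ≤ q) :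
    ∃ C : ℝ≥0, ∀ (g : ℝ → ℂ) (n : ℕ), Measurable g → MemLp g 2 volume →
      (∀ u ∉ capWindow n, g u = 0) →
      eLpNorm (waveIntegral g) (ENNReal.ofReal (2 * q)) volume
        ≤ C * capNorm g (ENNReal.ofReal (2 * q / (2 * q - 3))) := by
  obtain ⟨C, hC⟩ := exists_eLpNorm_waveIntegral_sum_le hq
  refine ⟨C, fun g n hgm hg hn => ?_⟩
  have h := hC (fun k => (unitCap k).indicator g) (fun k => hgm.indicator (measurableSet_unitCap k))
    (fun k => memLp_one_iff_integrable.1 (memLp_unitCap hg k (by simp)))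
    (fun k u hu => Set.indicator_of_notMem hu g)
    (fun k => memLp_unitCap hg k (two_mul_div_le_two hq)) (Finset.Icc (-(n : ℤ)) n)
  rw [sum_unitCap_indicator hn] at h
  refine h.trans ?_
  unfold capNorm
  gcongr
  exact ENNReal.sum_le_tsum _

/-! ### Construction of the extension on all of `L²`. -/

open Filter Topology
open scoped FourierTransform SchwartzMap

/-- The restriction of the Fourier transform of a test function to the hyperbola decays. -/
theorem exists_norm_integral_wave_mul_le {φ : ℝ × ℝ → ℂ} (hφ : ContDiff ℝ ∞ φ)
    (hs : HasCompactSupport φ) :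
    ∃ C : ℝ, ∀ u, ‖∫ z, wave z u * φ z‖ ≤ C / Real.cosh u := by
  have mp : MeasurePreserving (@WithLp.ofLp 2 (ℝ × ℝ)) := WithLp.volume_preserving_ofLp ℝ ℝ
  have me : MeasurableEmbedding (@WithLp.ofLp 2 (ℝ × ℝ)) :=
    (MeasurableEquiv.toLp 2 (ℝ × ℝ)).symm.measurableEmbedding
  have h1 : ContDiff ℝ ∞ (φ ∘ @WithLp.ofLp 2 (ℝ × ℝ)) :=
    hφ.comp (WithLp.prodContinuousLinearEquiv 2 ℝ ℝ ℝ).contDiff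
  have h2 : HasCompactSupport (φ ∘ @WithLp.ofLp 2 (ℝ × ℝ)) :=
    hs.comp_homeomorph (WithLp.prodContinuousLinearEquiv 2 ℝ ℝ ℝ).toHomeomorph
  set s : 𝓢(WithLp 2 (ℝ × ℝ), ℂ) := h2.toSchwartzMap h1 with hsdef
  obtain ⟨C, -, hC⟩ := (𝓕 s).decay 1 0
  refine ⟨C * (2 * Real.pi), fun u => ?_⟩
  set ξ : WithLp 2 (ℝ × ℝ) := WithLp.toLp 2
    (-(1 / (2 * Real.pi)) * Real.sinh u, -(1 / (2 * Real.pi)) * Real.cosh u) with hξ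
  have hF : ∫ z, wave z u * φ z = (𝓕 s) ξ := by
    rw [SchwartzMap.fourier_coe, Real.fourier_eq', ← mp.integral_comp me]
    refine integral_congr_ae (Eventually.of_forall fun z => ?_)
    simp only [smul_eq_mul, WithLp.prod_inner_apply, RCLike.inner_apply, conj_trivial]
    rw [wave]
    congr 4
    simp only [hξ]
    field_simp
    ring
  -- The frequency has second coordinate of size `cosh u / (2π)`, so first order decay of the
  -- Schwartz function `𝓕 s` suffices.
  have hn : Real.cosh u / (2 * Real.pi) ≤ ‖ξ‖ := by
    have h3 : ‖ξ.snd‖ ≤ ‖ξ‖ := WithLp.norm_snd_le _ ξ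
    refine le_trans (le_of_eq ?_) h3
    change _ = ‖-(1 / (2 * Real.pi)) * Real.cosh u‖
    rw [Real.norm_eq_abs, abs_mul, abs_neg, abs_of_pos (by positivity),
      abs_of_pos (Real.cosh_pos u)]
    ring
  have h4 := hC ξ
  rw [pow_one, norm_iteratedFDeriv_zero, ← hF] at h4
  rw [le_div_iff₀ (Real.cosh_pos u)]
  calc ‖∫ z, wave z u * φ z‖ * Real.cosh u
      = (Real.cosh u / (2 * Real.pi) * ‖∫ z, wave z u * φ z‖) * (2 * Real.pi) := by
        field_simp
    _ ≤ (‖ξ‖ * ‖∫ z, wave z u * φ z‖) * (2 * Real.pi) := by gcongr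
    _ ≤ _ := by gcongr

/-- Square integrability comes from decay like `1/cosh u` and `cosh² u ≥ 1 + u²`. It makes the
pairing with an `L²` function absolutely convergent, although the integral for the extension itself
need not be. -/
theorem memLp_integral_wave_mul {φ : ℝ × ℝ → ℂ} (hφ : ContDiff ℝ ∞ φ)
    (hs : HasCompactSupport φ) : MemLp (fun u => ∫ z, wave z u * φ z) 2 volume := by
  obtain ⟨C, hC⟩ := exists_norm_integral_wave_mul_le hφ hs
  have hφi : Integrable φ volume := hφ.continuous.integrable_of_hasCompactSupport hs
  have hm : AEStronglyMeasurable (fun u => ∫ z, wave z u * φ z) volume :=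
    ((continuous_wave.measurable.comp measurable_swap).aestronglyMeasurable.mul hφi.1.comp_snd :
      AEStronglyMeasurable (fun p : ℝ × (ℝ × ℝ) => wave p.2 p.1 * φ p.2)
        (volume.prod volume)).integral_prod_right'
  have hd : MemLp (fun u : ℝ => C / Real.cosh u) 2 volume := by
    have hc : Continuous fun u : ℝ => C / Real.cosh u :=
      continuous_const.div Real.continuous_cosh fun u => (Real.cosh_pos u).ne'
    rw [memLp_two_iff_integrable_sq hc.aestronglyMeasurable]
    refine (integrable_inv_one_add_sq.const_mul (C ^ 2)).mono' (hc.pow 2).aestronglyMeasurable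
      (Eventually.of_forall fun u => ?_)
    rw [Real.norm_of_nonneg (sq_nonneg _), div_pow, div_eq_mul_inv]
    gcongr
    rw [Real.cosh_sq, add_comm (Real.sinh u ^ 2)]
    gcongr 1 + ?_
    rw [← sq_abs u, ← sq_abs (Real.sinh u), Real.abs_sinh]
    gcongr
    exact Real.self_le_sinh_iff.2 (abs_nonneg u)
  exact hd.of_le hm (Eventually.of_forall fun u => (hC u).trans (le_abs_self _))

theorem tendsto_eLpNorm_capWindow_indicator_sub {g : ℝ → ℂ} (hgm : Measurable g)
    (hg : MemLp g 2 volume) :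
    Tendsto (fun n => eLpNorm ((capWindow n).indicator g - g) 2 volume) atTop (𝓝 0) := by
  have h : Tendsto (fun n => ∫⁻ u, ‖((capWindow n).indicator g - g) u‖ₑ ^ 2) atTop
      (𝓝 (∫⁻ _ : ℝ, 0)) := by
    refine tendsto_lintegral_of_dominated_convergence (fun u => ‖g u‖ₑ ^ 2) (fun n => ?_)
      (fun n => Eventually.of_forall fun u => ?_) ?_ (Eventually.of_forall fun u => ?_)
    · exact (((hgm.indicator (measurableSet_capWindow n)).sub hgm).enorm.pow_const 2)
    · by_cases hu : u ∈ capWindow n <;> simp [hu]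
    · rw [← eLpNorm_two_sq_eq_lintegral]
      exact ENNReal.pow_ne_top hg.2.ne
    · obtain ⟨N, hN⟩ := exists_mem_capWindow u
      refine tendsto_const_nhds.congr' ?_
      filter_upwards [eventually_ge_atTop N] with n hn
      simp [capWindow_mono hn hN]
  rw [lintegral_zero] at h
  have h2 := h.ennrpow_const (1 / 2)
  rw [ENNReal.zero_rpow_of_pos (by norm_num)] at h2
  refine h2.congr fun n => ?_
  rw [← eLpNorm_two_sq_eq_lintegral, ← ENNReal.rpow_two, ← ENNReal.rpow_mul]
  norm_num

theorem waveIntegral_sub {g h : ℝ → ℂ} (hg : Integrable g) (hh : Integrable h) :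
    waveIntegral (g - h) = waveIntegral g - waveIntegral h := by
  funext z
  simp only [waveIntegral, Pi.sub_apply, mul_sub]
  exact integral_sub
    (integrable_mul_of_bounded continuous_wave.measurable (fun z u => (norm_wave z u).le) hg z)
    (integrable_mul_of_bounded continuous_wave.measurable (fun z u => (norm_wave z u).le) hh z)

variable {g : ℝ → ℂ}

theorem memLp_capWindow (hg : MemLp g 2 volume) (n : ℕ) :
    MemLp ((capWindow n).indicator g) 2 volume := hg.indicator (measurableSet_capWindow n)

theorem integrable_capWindow (hg : MemLp g 2 volume) (n : ℕ) :
    Integrable ((capWindow n).indicator g) :=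
  integrable_of_capWindow (memLp_capWindow hg n) fun _ hu => Set.indicator_of_notMem hu g

/-- The extensions of the truncations of an `L²` function converge in `L⁶`. -/
theorem exists_tendsto_eLpNorm_waveIntegral (hgm : Measurable g) (hg : MemLp g 2 volume) :
    ∃ F : ℝ × ℝ → ℂ, MemLp F 6 volume ∧
      Tendsto (fun n => eLpNorm (waveIntegral ((capWindow n).indicator g) - F) 6 volume)
        atTop (𝓝 0) := by
  -- At `q = 3` the exponents are `2q = 6` and `2q/(2q-3) = 2`.
  obtain ⟨C, hC⟩ := exists_eLpNorm_waveIntegral_le (le_refl (3 : ℝ))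
  have h6 : ENNReal.ofReal (2 * 3) = 6 := by norm_num
  have hC6 : ∀ (h : ℝ → ℂ) (n : ℕ), Measurable h → MemLp h 2 volume →
      (∀ u ∉ capWindow n, h u = 0) →
      eLpNorm (waveIntegral h) 6 volume ≤ C * eLpNorm h 2 volume := by
    intro h n hm hh hn
    rw [← h6]
    refine (hC h n hm hh hn).trans ?_
    gcongr
    exact capNorm_le_eLpNorm hh.1 (two_mul_div_le_two le_rfl)
  have hgn := memLp_capWindow hg
  have hgnm : ∀ n, Measurable ((capWindow n).indicator g) := fun n =>
    hgm.indicator (measurableSet_capWindow n)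
  have hgi := integrable_capWindow hg
  have hF : ∀ n, MemLp (waveIntegral ((capWindow n).indicator g)) 6 volume := fun n =>
    ⟨(continuous_waveIntegral (hgi n)).aestronglyMeasurable,
      (hC6 _ n (hgnm n) (hgn n) fun u hu => Set.indicator_of_notMem hu g).trans_lt
        (ENNReal.mul_lt_top ENNReal.coe_lt_top (hgn n).2)⟩
  have : Fact ((1 : ℝ≥0∞) ≤ 6) := ⟨by norm_num⟩
  have hg2 := ((Lp.tendsto_Lp_iff_tendsto_eLpNorm'' _ hgn g hg).2
    (tendsto_eLpNorm_capWindow_indicator_sub hgm hg)).cauchySeq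
  rw [Lp.cauchySeq_Lp_iff_cauchySeq_eLpNorm] at hg2
  have hcau : CauchySeq fun n => (hF n).toLp _ := by
    rw [Lp.cauchySeq_Lp_iff_cauchySeq_eLpNorm]
    have hlim := ENNReal.Tendsto.const_mul hg2 (Or.inr (ENNReal.coe_ne_top (r := C)))
    rw [mul_zero] at hlim
    refine tendsto_of_tendsto_of_tendsto_of_le_of_le tendsto_const_nhds hlim
      (fun _ => zero_le) fun nm => ?_
    obtain ⟨n, m⟩ := nm
    simp only
    rw [eLpNorm_congr_ae ((hF n).coeFn_toLp.sub (hF m).coeFn_toLp),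
      eLpNorm_congr_ae ((hgn n).coeFn_toLp.sub (hgn m).coeFn_toLp),
      ← waveIntegral_sub (hgi n) (hgi m)]
    -- The difference of two truncations is supported in the larger window, so the same bound turns
    -- `L²` Cauchy into `L⁶` Cauchy.
    refine hC6 _ (max n m) ((hgnm n).sub (hgnm m)) ((hgn n).sub (hgn m)) fun u hu => ?_
    have hun : u ∉ capWindow n := fun h => hu (capWindow_mono (le_max_left n m) h)
    have hum : u ∉ capWindow m := fun h => hu (capWindow_mono (le_max_right n m) h)
    simp [hun, hum]
  obtain ⟨F, hFlim⟩ := cauchySeq_tendsto_of_complete hcau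
  refine ⟨F, Lp.memLp F, ?_⟩
  rw [Lp.tendsto_Lp_iff_tendsto_eLpNorm'] at hFlim
  refine hFlim.congr fun n => ?_
  exact eLpNorm_congr_ae ((hF n).coeFn_toLp.sub (ae_eq_refl _))

theorem tendsto_integral_mul_of_tendsto_eLpNorm_six {Z : Type*} [MeasurableSpace Z]
    {ν : Measure Z} {F : ℕ → Z → ℂ} {G φ : Z → ℂ} (hF : ∀ n, AEStronglyMeasurable (F n) ν)
    (hG : MemLp G 6 ν)
    (hφ : MemLp φ (ENNReal.ofReal (6 / 5)) ν)
    (h : Tendsto (fun n => eLpNorm (F n - G) 6 ν) atTop (𝓝 0)) :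
    Tendsto (fun n => ∫ z, F n z * φ z ∂ν) atTop (𝓝 (∫ z, G z * φ z ∂ν)) := by
  have hc : (6 : ℝ).HolderConjugate (6 / 5) := by
    rw [Real.holderConjugate_iff]; norm_num
  set A := (∫⁻ z, ‖φ z‖ₑ ^ (6 / 5 : ℝ) ∂ν) ^ (1 / (6 / 5) : ℝ) with hA
  have hAt : A ≠ ⊤ := by
    have := hφ.2.ne
    rwa [eLpNorm_eq_lintegral_rpow_enorm_toReal (by norm_num) ENNReal.ofReal_ne_top,
      ENNReal.toReal_ofReal (by norm_num)] at this
  have hbound : ∀ H : Z → ℂ, AEStronglyMeasurable H ν →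
      ∫⁻ z, ‖H z * φ z‖ₑ ∂ν ≤ eLpNorm H 6 ν * A := by
    intro H hH
    simp only [enorm_mul]
    refine (ENNReal.lintegral_mul_le_Lp_mul_Lq ν hc hH.enorm hφ.1.enorm).trans_eq ?_
    rw [eLpNorm_eq_lintegral_rpow_enorm_toReal (by norm_num) (by norm_num)]
    norm_num [hA]
  have hGi : Integrable (fun z => G z * φ z) ν :=
    ⟨hG.1.mul hφ.1, (hbound G hG.1).trans_lt (ENNReal.mul_lt_top hG.2 hAt.lt_top)⟩
  have hlim : Tendsto (fun n => eLpNorm (F n - G) 6 ν * A) atTop (𝓝 0) := by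
    have := ENNReal.Tendsto.mul_const h (Or.inr hAt)
    rwa [zero_mul] at this
  have hle : ∀ n, ∫⁻ z, ‖F n z * φ z - G z * φ z‖ₑ ∂ν ≤ eLpNorm (F n - G) 6 ν * A := fun n => by
    refine le_of_eq_of_le ?_ (hbound (F n - G) ((hF n).sub hG.1))
    simp [sub_mul]
  refine tendsto_integral_of_L1 _ hGi.1 ?_
    (tendsto_of_tendsto_of_tendsto_of_le_of_le tendsto_const_nhds hlim (fun _ => zero_le) hle)
  -- Only measurability of `F n` is assumed, so `F n * φ` is integrable merely for large `n`, once
  -- its `L¹` distance to `G * φ` is finite.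
  filter_upwards [hlim.eventually (gt_mem_nhds ENNReal.zero_lt_top)] with n hn
  have hd : Integrable (fun z => F n z * φ z - G z * φ z) ν :=
    ⟨((hF n).mul hφ.1).sub hGi.1, (hle n).trans_lt hn⟩
  refine (hd.add hGi).congr (Eventually.of_forall fun z => ?_)
  simp

/-- For truncations the identity is Fubini. The left side passes to the limit by `L⁶` convergence
and Hölder, the right side by dominated convergence. -/
theorem integral_mul_eq_of_tendsto (hg : MemLp g 2 volume)
    {F : ℝ × ℝ → ℂ} (hF : MemLp F 6 volume)
    (hlim : Tendsto (fun n => eLpNorm (waveIntegral ((capWindow n).indicator g) - F) 6 volume)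
        atTop (𝓝 0)) {φ : ℝ × ℝ → ℂ} (hφ : ContDiff ℝ ∞ φ) (hs : HasCompactSupport φ) :
    ∫ z, F z * φ z = ∫ u, g u * (∫ z, wave z u * φ z) := by
  have hφi : Integrable φ volume := hφ.continuous.integrable_of_hasCompactSupport hs
  have hφp : MemLp φ (ENNReal.ofReal (6 / 5)) volume := hφ.continuous.memLp_of_hasCompactSupport hs
  have h1 := tendsto_integral_mul_of_tendsto_eLpNorm_six
    (fun n => (continuous_waveIntegral (integrable_capWindow hg n)).aestronglyMeasurable) hF hφp hlim
  have hT := memLp_integral_wave_mul hφ hs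
  have hint : Integrable (fun u => g u * (∫ z, wave z u * φ z)) volume := hg.integrable_mul hT
  have h2 : Tendsto (fun n => ∫ u, (capWindow n).indicator g u * (∫ z, wave z u * φ z)) atTop
      (𝓝 (∫ u, g u * (∫ z, wave z u * φ z))) := by
    refine tendsto_integral_of_dominated_convergence (fun u => ‖g u * (∫ z, wave z u * φ z)‖)
      (fun n => (memLp_capWindow hg n).1.mul hT.1) hint.norm
      (fun n => Eventually.of_forall fun u => ?_) (Eventually.of_forall fun u => ?_)
    · by_cases hu : u ∈ capWindow n
      · simp [hu]
      · simp only [Set.indicator_of_notMem hu, zero_mul, norm_zero]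
        positivity
    · obtain ⟨N, hN⟩ := exists_mem_capWindow u
      refine tendsto_const_nhds.congr' ?_
      filter_upwards [eventually_ge_atTop N] with n hn
      simp [capWindow_mono hn hN]
  refine tendsto_nhds_unique h1 (h2.congr fun n => ?_)
  exact (integral_oscillatory_mul continuous_wave.measurable (fun z u => (norm_wave z u).le)
    (integrable_capWindow hg n) hφi).symm

/-- Convergence in `L⁶` gives a subsequence converging almost everywhere, and Fatou's lemma along it
carries over uniform bounds in any exponent `p`. -/
theorem eLpNorm_le_of_tendsto (hg : MemLp g 2 volume) {F : ℝ × ℝ → ℂ} (hF : MemLp F 6 volume)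
    (hlim : Tendsto (fun n => eLpNorm (waveIntegral ((capWindow n).indicator g) - F) 6 volume)
        atTop (𝓝 0)) {p B : ℝ≥0∞}
    (hB : ∀ n, eLpNorm (waveIntegral ((capWindow n).indicator g)) p volume ≤ B) :
    eLpNorm F p volume ≤ B := by
  have hm : ∀ n, AEStronglyMeasurable (waveIntegral ((capWindow n).indicator g)) volume := fun n =>
    (continuous_waveIntegral (integrable_capWindow hg n)).aestronglyMeasurable
  obtain ⟨ns, -, hns⟩ :=
    (tendstoInMeasure_of_tendsto_eLpNorm (by norm_num) hm hF.1 hlim).exists_seq_tendsto_ae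
  refine (Lp.eLpNorm_lim_le_liminf_eLpNorm (fun n => hm (ns n)) F hns).trans ?_
  exact liminf_le_of_le (by isBoundedDefault) fun b hb => by
    obtain ⟨n, hn⟩ := hb.exists
    exact hn.trans (hB _)

theorem isExtension_congr {f f' : ℝ → ℂ} (h : f =ᵐ[sigma] f') {F : ℝ × ℝ → ℂ}
    (hF : IsExtension f F) : IsExtension f' F := by
  refine ⟨hF.1, fun φ hφ hs => (hF.2 φ hφ hs).trans (integral_congr_ae ?_)⟩
  filter_upwards [h] with y hy
  rw [hy]

/-- The extension of a measurable `L²` function exists and is the limit in `L⁶` of the extensions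
of its truncations. -/
theorem exists_isExtension_tendsto {f : ℝ → ℂ} (hfm : Measurable f) (hf : MemLp f 2 sigma) :
    ∃ F : ℝ × ℝ → ℂ, IsExtension f F ∧ MemLp F 6 volume ∧
      Tendsto (fun n => eLpNorm (waveIntegral ((capWindow n).indicator (f ∘ Real.sinh)) - F) 6
        volume) atTop (𝓝 0) := by
  have hg : MemLp (f ∘ Real.sinh) 2 volume := hf.comp_measurePreserving measurePreserving_sinh
  obtain ⟨F, hF, hlim⟩ :=
    exists_tendsto_eLpNorm_waveIntegral (hfm.comp Real.continuous_sinh.measurable) hg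
  refine ⟨F, ⟨hF.locallyIntegrable (by norm_num), fun φ hφ hs => ?_⟩, hF, hlim⟩
  rw [integral_mul_eq_of_tendsto hg hF hlim hφ hs,
    ← measurePreserving_sinh.integral_comp measurableEmbedding_sinh]
  simp only [phase_sinh, Function.comp_apply]

theorem exists_isExtension {f : ℝ → ℂ} (hf : MemLp f 2 sigma) :
    ∃ F : ℝ × ℝ → ℂ, IsExtension f F := by
  have hae := hf.1.ae_eq_mk
  obtain ⟨F, hF, -⟩ := exists_isExtension_tendsto hf.1.stronglyMeasurable_mk.measurable
    ((memLp_congr_ae hae).1 hf)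
  exact ⟨F, isExtension_congr hae.symm hF⟩

/-- The refined extension inequality. -/
theorem exists_eLpNorm_extension_le {q : ℝ} (hq : 3 ≤ q) :
    ∃ C : ℝ≥0, ∀ (f : ℝ → ℂ) (F : ℝ × ℝ → ℂ), MemLp f 2 sigma → IsExtension f F →
      eLpNorm F (ENNReal.ofReal (2 * q)) volume
        ≤ C * capNorm (f ∘ Real.sinh) (ENNReal.ofReal (2 * q / (2 * q - 3))) := by
  obtain ⟨C, hC⟩ := exists_eLpNorm_waveIntegral_le hq
  refine ⟨C, fun f F hf hF => ?_⟩
  have hae := hf.1.ae_eq_mk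
  set f' := hf.1.mk f with hf'
  have hfm : Measurable f' := hf.1.stronglyMeasurable_mk.measurable
  have hf2 : MemLp f' 2 sigma := (memLp_congr_ae hae).1 hf
  have hg : MemLp (f' ∘ Real.sinh) 2 volume := hf2.comp_measurePreserving measurePreserving_sinh
  have hgae : f ∘ Real.sinh =ᵐ[volume] f' ∘ Real.sinh :=
    measurePreserving_sinh.quasiMeasurePreserving.ae_eq_comp hae
  obtain ⟨F', hF', hF6, hlim⟩ := exists_isExtension_tendsto hfm hf2
  have hcap : capNorm (f ∘ Real.sinh) (ENNReal.ofReal (2 * q / (2 * q - 3)))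
      = capNorm (f' ∘ Real.sinh) (ENNReal.ofReal (2 * q / (2 * q - 3))) := by
    unfold capNorm
    congr 2
    funext k
    rw [eLpNorm_congr_ae (hgae.indicator (s := unitCap k))]
  -- Uniqueness of the extension identifies the given `F` with the constructed `L⁶` limit.
  rw [eLpNorm_congr_ae ((isExtension_congr hae hF).ae_eq hF'), hcap]
  refine eLpNorm_le_of_tendsto hg hF6 hlim fun n => ?_
  refine (hC _ n ((hfm.comp Real.continuous_sinh.measurable).indicator (measurableSet_capWindow n))
    (memLp_capWindow hg n) fun u hu => Set.indicator_of_notMem hu _).trans ?_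
  gcongr
  exact capNorm_indicator_le _ _ _

end Hyperbola

end

theorem mainTheorem5 :
    -- `T f` is defined for every `f` in `L²(ℍ¹)`
    (∀ f : ℝ → ℂ, MemLp f 2 Hyperbola.sigma →
      ∃ F : ℝ × ℝ → ℂ, Hyperbola.IsExtension f F) ∧
    -- the refined extension inequality
    (∀ q : ℝ, 3 ≤ q → ∃ C : ℝ≥0, ∀ (f : ℝ → ℂ) (F : ℝ × ℝ → ℂ),
      MemLp f 2 Hyperbola.sigma → Hyperbola.IsExtension f F →
        eLpNorm F (ENNReal.ofReal (2 * q)) volume ≤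
          (C : ℝ≥0∞) *
            (∑' k : ℤ, eLpNorm ((Hyperbola.cap k).indicator f)
              (ENNReal.ofReal (2 * q / (2 * q - 3))) Hyperbola.sigma ^ (3 : ℕ)) ^ (1 / 3 : ℝ)) ∧
    -- the cap bound
    (∀ p : ℝ, 6 ≤ p → ∃ C : ℝ≥0, ∀ (f : ℝ → ℂ) (F : ℝ × ℝ → ℂ),
      MemLp f 2 Hyperbola.sigma → Hyperbola.IsExtension f F →
        eLpNorm F (ENNReal.ofReal p) volume ≤
          (C : ℝ≥0∞) *
            (⨆ k : ℤ, eLpNorm ((Hyperbola.cap k).indicator f) 2 Hyperbola.sigma ^ (1 / 3 : ℝ)) *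
            eLpNorm f 2 Hyperbola.sigma ^ (2 / 3 : ℝ)) := by
  refine ⟨fun f hf => Hyperbola.exists_isExtension hf, fun q hq => ?_, fun p hp => ?_⟩
  · obtain ⟨C, hC⟩ := Hyperbola.exists_eLpNorm_extension_le hq
    refine ⟨C, fun f F hf hF => (hC f F hf hF).trans_eq ?_⟩
    simp only [Hyperbola.capNorm, Hyperbola.eLpNorm_cap_indicator hf.1]
  -- The cap bound is the refined inequality at `q = p/2`, followed by interpolation of the cap
  -- norm.
  · have hq : 3 ≤ p / 2 := by linarith
    obtain ⟨C, hC⟩ := Hyperbola.exists_eLpNorm_extension_le hq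
    refine ⟨C, fun f F hf hF => ?_⟩
    have h := hC f F hf hF
    rw [mul_div_cancel₀ p (two_ne_zero' ℝ)] at h
    refine h.trans ?_
    simp only [Hyperbola.eLpNorm_cap_indicator hf.1]
    rw [mul_assoc, ← eLpNorm_comp_measurePreserving hf.1 Hyperbola.measurePreserving_sinh]
    refine mul_le_mul_right (Hyperbola.capNorm_le
      (hf.comp_measurePreserving Hyperbola.measurePreserving_sinh).1 ?_) _
    have := Hyperbola.two_mul_div_le_two hq
    rwa [mul_div_cancel₀ p (two_ne_zero' ℝ)] at this
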